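/- Let $\mu\neq 0$ be a complex (finite) Borel measure on $(0,\infty)$ with $\int_0^\infty d\mu(t)=0$. Put $F(z)=\mathcal L\mu(z)=\int_0^\infty e^{-z\xi}\,d\mu(\xi)$ for $\operatorname{Re} z\ge 0$, and $\widetilde F=\mathcal L\overline{\mu}$, where $\overline\mu(E)=\overline{\mu(E)}$. Let $(T(t))_{t>0}$ be a strongly continuous semigroup of bounded operators on a complex Banach space $X$, that is, $T(s+t)=T(s)T(t)$ for $s,t>0$ and $t\mapsto T(t)x$ is continuous on $(0,\infty)$ for every $x\in X$. Assume that it is quasinilpotent (every $T(t)$, $t>0$, has spectral radius $0$) and nontrivial ($T(t)\ne0$ for some $t>0$). Let $A$ be its generator. For $s>0$ write $$F(-sA)x=\int_0^\infty T(s\xi)x\,d\mu(\xi),\qquad \widetilde F(-sA)x=\int_0^\infty T(s\xi)x\,d\overline\mu(\xi)\qquad(x\in X);$$ we say that $F(-sA)$ is defined if, for every $x\in X$, $\xi\mapsto T(s\xi)x$ is Bochner integrable with respect to the total variation $|\mu|$ (equivalently $|\overline\mu|$). Then: 1. If $T$ is bounded near $0$ (that is, $\sup_{0<t\le\delta}\|T(t)\|<\infty$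 for some $\delta>0$), or if $|\mu|((0,\delta))=0$ for some $\delta>0$, then $F(-sA)$ is defined for every $s>0$. 2. The maximum $\max_{x\ge0}|F(x)|^2$ exists, and there is $\eta>0$ such that for every $s$ with $0<s\le\eta$ for which $F(-sA)$ is defined, $F(-sA)$ and $\widetilde F(-sA)$ are bounded operators on $X$ and $$\big\|F(-sA)\,\widetilde F(-sA)\big\|>\max_{x\ge 0}|F(x)|^2 .$$ -/

import Mathlib

open MeasureTheory

/-- The conjugate measure `E ↦ conj (μ E)` of a complex measure `μ`. -/
noncomputable def conjMeasure {α : Type*} [MeasurableSpace α] (μ : ComplexMeasure α) :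
    ComplexMeasure α :=
  μ.mapRange (starRingEnd ℂ).toAddMonoidHom Complex.continuous_conj

/-- The Bochner integral `∫ f dμ` of a vector-valued function against a complex measure, the
pairing being scalar multiplication. It is meaningful when `f` is Bochner integrable with respect
to the total variation of `μ`. -/
noncomputable def complexIntegral {α X : Type*} [MeasurableSpace α] [NormedAddCommGroup X]
    [NormedSpace ℂ X] (μ : ComplexMeasure α) (f : α → X) : X :=
  μ.integral f (ContinuousLinearMap.lsmul ℝ ℂ : ℂ →L[ℝ] X →L[ℝ] X).flip

/-- The Laplace transform `(ℒ μ)(z) = ∫ exp (-z ξ) dμ(ξ)` of a complex Borel measure on `(0, ∞)`. -/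
noncomputable def laplace (μ : ComplexMeasure (Set.Ioi (0 : ℝ))) (z : ℂ) : ℂ :=
  complexIntegral μ (fun ξ : Set.Ioi (0 : ℝ) => Complex.exp (-z * ((ξ : ℝ) : ℂ)))

/-- `(T t)` for `t > 0` is a strongly continuous semigroup of bounded operators on `X`. Nothing is
required as `t → 0+`, and the values of `T` at `t ≤ 0` are irrelevant. -/
structure IsStronglyContinuousSemigroup {X : Type*} [NormedAddCommGroup X] [NormedSpace ℂ X]
    (T : ℝ → X →L[ℂ] X) : Prop where
  map_add : ∀ s t : ℝ, 0 < s → 0 < t → T (s + t) = (T s).comp (T t)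
  continuousOn : ∀ x : X, ContinuousOn (fun t : ℝ => T t x) (Set.Ioi 0)

/-- Every `T t` with `t > 0` has spectral radius zero. -/
def IsQuasinilpotent {X : Type*} [NormedAddCommGroup X] [NormedSpace ℂ X]
    (T : ℝ → X →L[ℂ] X) : Prop :=
  ∀ t : ℝ, 0 < t → spectralRadius ℂ (T t) = 0

/-- The integrals `∫ T (s ξ) x dμ(ξ)`, `x ∈ X`, which define `F (-s A)` for `F = ℒ μ` and the
generator `A` of `T`, all exist as Bochner integrals. -/
def CalculusDefined {X : Type*} [NormedAddCommGroup X] [NormedSpace ℂ X]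
    (T : ℝ → X →L[ℂ] X) (μ : ComplexMeasure (Set.Ioi (0 : ℝ))) (s : ℝ) : Prop :=
  ∀ x : X, μ.Integrable (fun ξ : Set.Ioi (0 : ℝ) => T (s * (ξ : ℝ)) x)

/-- The bounded operator `P` is `F (-s A)`, where `F = ℒ μ` and `A` is the generator of `T`:
for all `x`, the integral `∫ T (s ξ) x dμ(ξ)` exists as a Bochner integral and equals `P x`. -/
def IsCalculus {X : Type*} [NormedAddCommGroup X] [NormedSpace ℂ X]
    (T : ℝ → X →L[ℂ] X) (μ : ComplexMeasure (Set.Ioi (0 : ℝ))) (s : ℝ) (P : X →L[ℂ] X) : Prop :=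
  CalculusDefined T μ s ∧
    ∀ x : X, P x = complexIntegral μ (fun ξ : Set.Ioi (0 : ℝ) => T (s * (ξ : ℝ)) x)

/-! Suppose that `‖F(-sA) F̃(-sA)‖ ≤ M`, with `M` the maximum of `|F|²`, for arbitrarily small
admissible `s`. For `a > 0` and `x` in `X`, put `R_s(z) = ∫ exp(zt) T(st+a)x dt`, formally
`-(z+sA)⁻¹ T(a)x`. Quasinilpotence makes `T` decay faster than every exponential, so `R_s` is
entire. On the left half-plane it is `O(1/|re z|)`. On the right, `exp(-zξ) R_s(z) - T(sξ) R_s(z)`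
is an integral over `[0, ξ]` and is `O(1/re z)` uniformly in `ξ`; integrating against `μ` and its
conjugate gives `(|G(z)| - M) ‖R_s(z)‖ = O(1/re z)`, where `G = F F̃`. No constant depends on `s`.
These estimates bound `R_s(0)` independently of `s` (`exists_norm_apply_zero_le`, applied after a
functional). But `R_s(0) = s⁻¹ ∫ T(t+a)x dt`, so `s → 0` forces the integral to vanish for all `a`
and `x`, whence `T = 0`. The bound at `0` is Cauchy's formula on a loop around `0` along which the
estimates are available. On the positive axis `G = |F|²`, with its maximum `M` at some `x₀ > 0`.
From `x₀` the loop enters the upper half-plane in a direction where `re G > M`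
(`exists_direction_re_growth`). By a Phragmén–Lindelöf argument the component of `{|G| > M}` entered
there touches the imaginary axis at a point `q` with `|G(q)| > M`
(`exists_mem_closure_connectedComponentIn`), and `q ≠ 0` because `G(0) = 0`. The loop crosses the
axis near `q`, continues to a negative real point, and is closed by reflection. A polynomial
vanishing at `x₀`, `q` and `conj q` absorbs the blow-up of the estimates there. That `M > 0` is
injectivity of the Laplace transform. -/

/-! ### Complex analysis: a contour around the origin -/

/-- On an open connected set, the increment of a holomorphic function between two points is bounded
in terms of a continuous bound of its derivative. -/
theorem exists_norm_sub_le_of_isPreconnected {U : Set ℂ} (hU : IsOpen U) (hc : IsPreconnected U)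
    {B : ℂ → ℝ} (hB : ContinuousOn B U) {p q : ℂ} (hp : p ∈ U) (hq : q ∈ U) :
    ∃ K : ℝ, ∀ Ψ Ψ' : ℂ → ℂ, (∀ z ∈ U, HasDerivAt Ψ (Ψ' z) z) → (∀ z ∈ U, ‖Ψ' z‖ ≤ B z) →
      ‖Ψ q - Ψ p‖ ≤ K := by
  -- Having a uniformly bounded increment is a local, transitive and symmetric relation between
  -- points, so connectedness suffices and no path has to be chosen.
  refine hc.induction₂ (fun p q : ℂ => ∃ K : ℝ, ∀ Ψ Ψ' : ℂ → ℂ,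
    (∀ z ∈ U, HasDerivAt Ψ (Ψ' z) z) → (∀ z ∈ U, ‖Ψ' z‖ ≤ B z) → ‖Ψ q - Ψ p‖ ≤ K) ?_ ?_ ?_ hp hq
  · intro x hx
    have h1 : ∀ᶠ y in nhds x, B y < B x + 1 :=
      (hB.continuousAt (hU.mem_nhds hx)).eventually_lt_const (by linarith)
    obtain ⟨r, hr, hr'⟩ := Metric.eventually_nhds_iff_ball.1 (h1.and (hU.mem_nhds hx))
    refine Filter.Eventually.filter_mono nhdsWithin_le_nhds ?_
    filter_upwards [Metric.ball_mem_nhds x hr] with y hy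
    refine ⟨(B x + 1) * ‖y - x‖, fun Ψ Ψ' h h' => ?_⟩
    exact (convex_ball x r).norm_image_sub_le_of_norm_hasDerivWithin_le
      (fun z hz => (h z (hr' z hz).2).hasDerivWithinAt)
      (fun z hz => (h' z (hr' z hz).2).trans (hr' z hz).1.le) (Metric.mem_ball_self hr) hy
  · rintro x y z - - - ⟨K, hK⟩ ⟨L, hL⟩
    refine ⟨L + K, fun Ψ Ψ' h h' => ?_⟩
    calc ‖Ψ z - Ψ x‖ = ‖(Ψ z - Ψ y) + (Ψ y - Ψ x)‖ := by ring_nf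
      _ ≤ _ := (norm_add_le _ _).trans (add_le_add (hL Ψ Ψ' h h') (hK Ψ Ψ' h h'))
  · rintro x y - - ⟨K, hK⟩
    exact ⟨K, fun Ψ Ψ' h h' => by rw [norm_sub_rev]; exact hK Ψ Ψ' h h'⟩

/-- A nonconstant holomorphic function which is real on a real interval to the right of `x₀` has a
direction in the open upper half-plane along which its real part grows at a polynomial rate. -/
theorem exists_direction_re_growth {G : ℂ → ℂ} {x₀ : ℝ} (hG : AnalyticAt ℂ G x₀)
    (hreal : ∀ᶠ t : ℝ in nhdsWithin x₀ (Set.Ioi x₀), (G t).im = 0) (hx₀ : (G x₀).im = 0)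
    (hne : ¬ ∀ᶠ z in nhds (x₀ : ℂ), G z = G x₀) :
    ∃ (n : ℕ) (ω : ℂ) (c r₀ : ℝ), n ≠ 0 ∧ 0 < ω.im ∧ 0 < c ∧ 0 < r₀ ∧
      ∀ r : ℝ, 0 ≤ r → r ≤ r₀ → (G x₀).re + c * r ^ n ≤ (G (x₀ + r * ω)).re := by
  have hf : AnalyticAt ℂ (fun z => G z - G x₀) x₀ := hG.sub analyticAt_const
  obtain ⟨n, g, hg, hg0, hfg⟩ := hf.exists_eventuallyEq_pow_smul_nonzero_iff.2
    (by simpa [sub_eq_zero] using hne)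
  simp only [smul_eq_mul] at hfg
  have hn : n ≠ 0 := by
    rintro rfl
    have := hfg.self_of_nhds
    simp at this
    exact hg0 this.symm
  have him : (g x₀).im = 0 := by
    have hcont : Filter.Tendsto (fun t : ℝ => (g t).im) (nhdsWithin x₀ (Set.Ioi x₀))
        (nhds (g x₀).im) := by
      have h1 : ContinuousAt (fun t : ℝ => (g t).im) x₀ :=
        Complex.continuous_im.continuousAt.comp
          (ContinuousAt.comp (f := fun t : ℝ => (t : ℂ)) hg.continuousAt
            Complex.continuous_ofReal.continuousAt)
      exact h1.tendsto.mono_left nhdsWithin_le_nhds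
    refine tendsto_nhds_unique hcont (Filter.Tendsto.congr' ?_ tendsto_const_nhds)
    have h2 : ∀ᶠ t : ℝ in nhds x₀, G t - G x₀ = (t - x₀ : ℂ) ^ n * g t :=
      Complex.continuous_ofReal.continuousAt.eventually hfg
    filter_upwards [hreal, h2.filter_mono nhdsWithin_le_nhds, self_mem_nhdsWithin] with t h3 h4 h5
    have h6 : (t - x₀) ^ n ≠ 0 := pow_ne_zero _ (sub_ne_zero.2 (ne_of_gt h5))
    have h7 := congrArg Complex.im h4
    rw [← Complex.ofReal_sub, ← Complex.ofReal_pow, Complex.im_ofReal_mul, Complex.sub_im, h3,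
      hx₀, sub_zero, eq_comm, mul_eq_zero] at h7
    exact (h7.resolve_left h6).symm
  have hn' : (0 : ℝ) < n := by positivity
  have hre : (g x₀).re ≠ 0 := fun h => hg0 (Complex.ext h him)
  -- The leading term of `re (G - G x₀)` along angle `θ` is `r ^ n * g x₀ * cos (n θ)` with `g x₀`
  -- real. The angle `π/(4n)` or `3π/(4n)`, according to the sign of `g x₀`, makes it positive and
  -- stays in the upper half-plane even for `n = 1`.
  obtain ⟨θ, hθ0, hθπ, hθ⟩ : ∃ θ : ℝ, 0 < θ ∧ θ < Real.pi ∧ 0 < (g x₀).re * Real.cos (n * θ) := by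
    have hn1 : (1 : ℝ) ≤ n := by exact_mod_cast Nat.one_le_iff_ne_zero.2 hn
    have hπ := Real.pi_pos
    rcases lt_or_gt_of_ne hre with h | h
    · refine ⟨3 * Real.pi / 4 / n, by positivity, ?_, ?_⟩
      · rw [div_lt_iff₀ hn']; nlinarith
      · rw [mul_div_cancel₀ _ hn'.ne']
        exact mul_pos_of_neg_of_neg h
          (Real.cos_neg_of_pi_div_two_lt_of_lt (by linarith) (by linarith))
    · refine ⟨Real.pi / 4 / n, by positivity, ?_, ?_⟩
      · rw [div_lt_iff₀ hn']; nlinarith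
      · rw [mul_div_cancel₀ _ hn'.ne']
        exact mul_pos h (Real.cos_pos_of_mem_Ioo ⟨by linarith, by linarith⟩)
  set ω : ℂ := Complex.exp (θ * Complex.I) with hω
  have hωim : 0 < ω.im := by
    rw [hω, Complex.exp_ofReal_mul_I_im]; exact Real.sin_pos_of_pos_of_lt_pi hθ0 hθπ
  have hωn : (ω ^ n).re = Real.cos (n * θ) := by
    rw [hω, ← Complex.exp_nat_mul, ← mul_assoc, ← Complex.ofReal_natCast, ← Complex.ofReal_mul,
      Complex.exp_ofReal_mul_I_re]
  set c : ℝ := (g x₀).re * Real.cos (n * θ) / 2 with hc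
  have hcurve : ContinuousAt (fun r : ℝ => (x₀ : ℂ) + r * ω) 0 := by fun_prop
  have hcurve0 : (x₀ : ℂ) + ((0 : ℝ) : ℂ) * ω = x₀ := by simp
  have e1 : ∀ᶠ r : ℝ in nhds 0, c < (ω ^ n * g (x₀ + r * ω)).re := by
    have h1 : ContinuousAt (fun r : ℝ => (ω ^ n * g (x₀ + r * ω)).re) 0 := by
      refine Complex.continuous_re.continuousAt.comp (continuousAt_const.mul ?_)
      refine ContinuousAt.comp (f := fun r : ℝ => (x₀ : ℂ) + r * ω) ?_ hcurve
      rw [hcurve0]; exact hg.continuousAt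
    refine h1.eventually_const_lt ?_
    beta_reduce
    rw [hcurve0, Complex.mul_re, him, hωn, hc]
    linarith
  have e2 : ∀ᶠ r : ℝ in nhds 0, G (x₀ + r * ω) - G x₀ =
      ((x₀ + r * ω : ℂ) - x₀) ^ n * g (x₀ + r * ω) := by
    have h1 := hcurve.tendsto
    rw [hcurve0] at h1
    exact h1.eventually hfg
  obtain ⟨ε, hε, hε'⟩ := Metric.eventually_nhds_iff_ball.1 (e1.and e2)
  refine ⟨n, ω, c, ε / 2, hn, hωim, by rw [hc]; linarith, by linarith, fun r hr0 hr => ?_⟩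
  have hr2 : r ∈ Metric.ball (0 : ℝ) ε := by
    rw [mem_ball_zero_iff, Real.norm_eq_abs, abs_of_nonneg hr0]; linarith
  obtain ⟨h1, h2⟩ := hε' r hr2
  have h3 := congrArg Complex.re h2
  rw [add_sub_cancel_left, mul_pow, mul_assoc, ← Complex.ofReal_pow, Complex.re_ofReal_mul,
    Complex.sub_re] at h3
  have := mul_le_mul_of_nonneg_left h1.le (pow_nonneg hr0 n)
  linarith

/-- A bounded holomorphic function on the right half-plane, continuous up to the boundary: a
connected component of the part of the open first quadrant on which it exceeds its bound on the
positive half-line reaches the imaginary axis at a point where it exceeds that bound. -/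
theorem exists_mem_closure_connectedComponentIn {G : ℂ → ℂ} {M b : ℝ}
    (hGd : DifferentiableOn ℂ G {z | 0 < z.re}) (hGc : ContinuousOn G {z | 0 ≤ z.re})
    (hGb : ∀ z : ℂ, 0 ≤ z.re → ‖G z‖ ≤ b) (hreal : ∀ x : ℝ, 0 ≤ x → ‖G x‖ ≤ M) (hM : 0 < M)
    {p : ℂ} (hp : p ∈ {z : ℂ | 0 < z.re ∧ 0 < z.im ∧ M < ‖G z‖}) :
    ∃ q ∈ closure (connectedComponentIn {z : ℂ | 0 < z.re ∧ 0 < z.im ∧ M < ‖G z‖} p),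
      q.re = 0 ∧ M < ‖G q‖ := by
  set S : Set ℂ := {z : ℂ | 0 < z.re ∧ 0 < z.im ∧ M < ‖G z‖} with hS
  set W := connectedComponentIn S p with hW
  by_contra! hcon
  have hopen : IsOpen {z : ℂ | 0 < z.re} := isOpen_lt continuous_const Complex.continuous_re
  have hSopen : IsOpen S := by
    have h1 : IsOpen ({z : ℂ | 0 < z.re} ∩ (fun z => ‖G z‖) ⁻¹' Set.Ioi M) :=
      (hGc.mono fun z (hz : 0 < z.re) => hz.le).norm.isOpen_inter_preimage hopen isOpen_Ioi
    have h2 : IsOpen {z : ℂ | 0 < z.im} := isOpen_lt continuous_const Complex.continuous_im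
    convert h1.inter h2 using 1
    ext z; simp [hS]; tauto
  have hWS : W ⊆ S := connectedComponentIn_subset S p
  have hWopen : IsOpen W := hSopen.connectedComponentIn
  have hpW : p ∈ W := mem_connectedComponentIn hp
  have hWcl : closure W ⊆ {z : ℂ | 0 ≤ z.re ∧ 0 ≤ z.im} := by
    refine closure_minimal (fun z hz => ⟨(hWS hz).1.le, (hWS hz).2.1.le⟩) ?_
    exact (isClosed_le continuous_const Complex.continuous_re).inter
      (isClosed_le continuous_const Complex.continuous_im)
  -- A frontier point with `M < ‖G z‖` can lie neither on the imaginary axis (contradiction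
  -- hypothesis) nor on the real axis (`hreal`). Inside the quadrant its own component would be open
  -- and meet `W`, hence equal `W`, which is impossible as `W` is open.
  have hfr : ∀ z ∈ frontier W, ‖G z‖ ≤ M := by
    intro z hz
    have hzc : z ∈ closure W := hz.1
    have hznW : z ∉ W := by rw [hWopen.frontier_eq] at hz; exact hz.2
    by_contra! hlt
    obtain ⟨h0, h1⟩ := hWcl hzc
    rcases h0.eq_or_lt with h0 | h0
    · exact absurd (hcon z hzc h0.symm) hlt.not_ge
    rcases h1.eq_or_lt with h1 | h1
    · have : z = (z.re : ℂ) := Complex.ext (by simp) (by simp [← h1])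
      rw [this] at hlt
      exact absurd (hreal _ h0.le) hlt.not_ge
    · have hzS : z ∈ S := ⟨h0, h1, hlt⟩
      have hV : IsOpen (connectedComponentIn S z) := hSopen.connectedComponentIn
      obtain ⟨w, hw1, hw2⟩ := mem_closure_iff.1 hzc _ hV (mem_connectedComponentIn hzS)
      have := (connectedComponentIn_eq hw1).trans (connectedComponentIn_eq hw2).symm
      exact hznW (by rw [hW, ← this]; exact mem_connectedComponentIn hzS)
  have hne : ∀ z : ℂ, 0 ≤ z.re → 1 ≤ ‖1 + z‖ := fun z hz => by
    have := Complex.re_le_norm (1 + z)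
    simp at this; linarith
  have hb0 : 0 ≤ b := (norm_nonneg _).trans (hGb 0 (by simp))
  -- Phragmén–Lindelöf: the divisor `1 + z` makes the bounded function `G ^ N` small on large
  -- circles. It costs a factor `‖1 + p‖` independent of `N`, which is beaten by letting `N` grow.
  have key : ∀ N : ℕ, ‖G p‖ ^ N ≤ M ^ N * ‖1 + p‖ := by
    intro N
    obtain ⟨R, hR⟩ : ∃ R : ℝ, ‖p‖ < R ∧ 1 < R ∧ b ^ N / (R - 1) ≤ M ^ N := by
      refine ⟨max ‖p‖ 1 + 1 + b ^ N / M ^ N, ?_, ?_, ?_⟩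
      · have := le_max_left ‖p‖ 1
        have : 0 ≤ b ^ N / M ^ N := by positivity
        linarith
      · have := le_max_right ‖p‖ 1
        have : 0 ≤ b ^ N / M ^ N := by positivity
        linarith
      · have h1 := le_max_right ‖p‖ 1
        have h2 : 0 ≤ b ^ N / M ^ N := by positivity
        have h3 : 0 < M ^ N := by positivity
        rw [div_le_iff₀ (by linarith)]
        have h4 : b ^ N = M ^ N * (b ^ N / M ^ N) := by field_simp
        have h5 : 0 ≤ M ^ N * max ‖p‖ 1 := by positivity
        linarith
    have hd : DiffContOnCl ℂ (fun z => G z ^ N / (1 + z)) (W ∩ Metric.ball 0 R) := by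
      constructor
      · intro z hz
        have hz' := (hWS hz.1).1
        have : 1 + z ≠ 0 := norm_pos_iff.1 (by linarith [hne z hz'.le])
        have hz2 : DifferentiableAt ℂ G z := hGd.differentiableAt (hopen.mem_nhds hz')
        exact ((hz2.pow N).div (by fun_prop) this).differentiableWithinAt
      · have hsub : closure (W ∩ Metric.ball 0 R) ⊆ {z : ℂ | 0 ≤ z.re} := fun z hz =>
          (hWcl (closure_mono Set.inter_subset_left hz)).1
        refine ((hGc.mono hsub).pow N).div (by fun_prop) fun z hz => ?_
        exact norm_pos_iff.1 (by linarith [hne z (hsub hz)])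
    have hle := Complex.norm_le_of_forall_mem_frontier_norm_le (C := M ^ N)
      (Metric.isBounded_ball.subset Set.inter_subset_right) hd ?_
      (subset_closure ⟨hpW, by simpa using hR.1⟩)
    · rwa [norm_div, norm_pow, div_le_iff₀ (by linarith [hne p hp.1.le])] at hle
    · intro z hz
      rw [norm_div, norm_pow]
      rcases frontier_inter_subset _ _ hz with ⟨h1, h2⟩ | ⟨h1, h2⟩
      · have h3 := hne z (hWcl h1.1).1
        have h4 : ‖G z‖ ^ N ≤ M ^ N := pow_le_pow_left₀ (norm_nonneg _) (hfr z h1) N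
        exact (div_le_self (by positivity) h3).trans h4
      · have h3 : ‖z‖ = R := by
          have := Metric.frontier_ball_subset_sphere h2
          simpa using this
        have h4 : R - 1 ≤ ‖1 + z‖ := by
          have := norm_sub_norm_le z (-1)
          rw [norm_neg, norm_one, h3, sub_neg_eq_add, add_comm z] at this
          exact this
        refine le_trans ?_ hR.2.2
        have h5 : ‖G z‖ ^ N ≤ b ^ N := pow_le_pow_left₀ (norm_nonneg _) (hGb z (hWcl h1).1) N
        gcongr
        linarith [hR.2.1]
  have hgt : 1 < ‖G p‖ / M := (one_lt_div hM).2 hp.2.2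
  obtain ⟨N, hN⟩ := pow_unbounded_of_one_lt ‖1 + p‖ hgt
  have := key N
  rw [div_pow, lt_div_iff₀ (by positivity)] at hN
  linarith

/-- Let `G` be a bounded holomorphic function on the right half-plane whose supremum `M` on the positive
half-line is attained at an interior point. Then the entire functions controlled by
`1 / |re z|` on the left half-plane, and by `1 / (re z * (‖G z‖ - M))` where `M < ‖G z‖`,
are uniformly bounded at the origin. -/
theorem exists_norm_apply_zero_le {G : ℂ → ℂ} {M b x₀ : ℝ}
    (hGd : DifferentiableOn ℂ G {z | 0 < z.re}) (hGc : ContinuousOn G {z | 0 ≤ z.re})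
    (hGb : ∀ z : ℂ, 0 ≤ z.re → ‖G z‖ ≤ b)
    (hconj : ∀ z : ℂ, 0 ≤ z.re → G (starRingEnd ℂ z) = starRingEnd ℂ (G z))
    (hreal : ∀ x : ℝ, 0 ≤ x → ‖G x‖ ≤ M) (hM : 0 < M) (hx₀ : 0 < x₀) (hGx₀ : G x₀ = M)
    (hG0 : G 0 = 0) (C : ℝ) :
    ∃ K : ℝ, ∀ f : ℂ → ℂ, Differentiable ℂ f →
      (∀ z : ℂ, z.re < 0 → ‖f z‖ ≤ C / (-z.re)) →
      (∀ z : ℂ, 0 < z.re → M < ‖G z‖ → ‖f z‖ ≤ C / (z.re * (‖G z‖ - M))) → ‖f 0‖ ≤ K := by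
  rcases lt_or_ge C 0 with hC | hC
  · refine ⟨0, fun f _ hf _ => ?_⟩
    have := (norm_nonneg _).trans (hf (-1) (by simp))
    simp at this
    linarith
  have hopen : IsOpen {z : ℂ | 0 < z.re} := isOpen_lt continuous_const Complex.continuous_re
  have hpre : IsPreconnected {z : ℂ | 0 < z.re} := (convex_halfSpace_re_gt 0).isPreconnected
  have hx₀mem : (x₀ : ℂ) ∈ {z : ℂ | 0 < z.re} := by simpa using hx₀
  have hGan : AnalyticOnNhd ℂ G {z : ℂ | 0 < z.re} := hGd.analyticOnNhd hopen
  -- Otherwise the identity theorem and continuity at the boundary would give `G 0 = M`.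
  have hne : ¬ ∀ᶠ z in nhds (x₀ : ℂ), G z = G x₀ := by
    intro h
    have h1 : Set.EqOn G (fun _ => G x₀) {z : ℂ | 0 < z.re} :=
      hGan.eqOn_of_preconnected_of_eventuallyEq analyticOnNhd_const hpre hx₀mem h
    have h2 : Filter.Tendsto (fun t : ℝ => G t) (nhdsWithin 0 (Set.Ioi 0)) (nhds (G 0)) := by
      have h3 : ContinuousWithinAt G {z : ℂ | 0 ≤ z.re} ((0 : ℝ) : ℂ) := hGc _ (by simp)
      have h4 := h3.tendsto.comp (f := fun t : ℝ => (t : ℂ)) (x := nhdsWithin 0 (Set.Ioi 0)) ?_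
      · simpa using! h4
      · refine tendsto_nhdsWithin_iff.2 ⟨?_, ?_⟩
        · exact (Complex.continuous_ofReal.tendsto 0).mono_left nhdsWithin_le_nhds
        · filter_upwards [self_mem_nhdsWithin] with t (ht : 0 < t)
          simpa using ht.le
    have h5 : G 0 = G x₀ := by
      refine tendsto_nhds_unique h2 (Filter.Tendsto.congr' ?_ tendsto_const_nhds)
      filter_upwards [self_mem_nhdsWithin] with t (ht : 0 < t)
      exact (h1 (show (t : ℂ) ∈ {z : ℂ | 0 < z.re} by simpa using ht)).symm
    rw [hG0, hGx₀] at h5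
    exact hM.ne (by exact_mod_cast h5)
  have hGreal : ∀ t : ℝ, 0 ≤ t → (G t).im = 0 := fun t ht => by
    have := hconj t (by simpa using ht)
    rw [Complex.conj_ofReal] at this
    exact Complex.conj_eq_iff_im.1 this.symm
  obtain ⟨n, ω, c, r₀, hn, hω, hc, hr₀, hgrow⟩ := exists_direction_re_growth (hGan _ hx₀mem)
    (by filter_upwards [self_mem_nhdsWithin] with t (ht : x₀ < t)
        exact hGreal t (hx₀.trans ht).le) (hGreal _ hx₀.le) hne
  simp only [hGx₀, Complex.ofReal_re] at hgrow
  -- shorten the segment so that it stays away from the imaginary axis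
  obtain ⟨r₁, hr₁, hr₁₀, hr₁re⟩ : ∃ r₁ : ℝ, 0 < r₁ ∧ r₁ ≤ r₀ ∧
      ∀ r : ℝ, 0 ≤ r → r ≤ r₁ → x₀ / 2 ≤ ((x₀ : ℂ) + r * ω).re := by
    refine ⟨min r₀ (x₀ / 2 / (|ω.re| + 1)), by positivity, min_le_left _ _, fun r h0 h1 => ?_⟩
    have h2 := h1.trans (min_le_right _ _)
    rw [le_div_iff₀ (by positivity)] at h2
    simp only [Complex.add_re, Complex.ofReal_re, Complex.re_ofReal_mul]
    nlinarith [neg_abs_le ω.re, abs_nonneg ω.re]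
  set S : Set ℂ := {z : ℂ | 0 < z.re ∧ 0 < z.im ∧ M < ‖G z‖} with hS
  have hSopen : IsOpen S := by
    have h1 : IsOpen ({z : ℂ | 0 < z.re} ∩ (fun z => ‖G z‖) ⁻¹' Set.Ioi M) :=
      hGd.continuousOn.norm.isOpen_inter_preimage hopen isOpen_Ioi
    have h2 : IsOpen {z : ℂ | 0 < z.im} := isOpen_lt continuous_const Complex.continuous_im
    convert h1.inter h2 using 1
    ext z; simp [hS]; tauto
  have hseg : ∀ r : ℝ, 0 < r → r ≤ r₁ → M + c * r ^ n ≤ ‖G (x₀ + r * ω)‖ := fun r h0 h1 =>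
    (hgrow r h0.le (h1.trans hr₁₀)).trans (Complex.re_le_norm _)
  set p : ℂ := x₀ + r₁ * ω with hp
  have hpS : p ∈ S := by
    refine ⟨lt_of_lt_of_le (by positivity) (hr₁re r₁ hr₁.le le_rfl), ?_, ?_⟩
    · simp [hp]; positivity
    · have := hseg r₁ hr₁ le_rfl
      have : 0 < c * r₁ ^ n := by positivity
      linarith
  obtain ⟨q, hqW, hq0, hqM⟩ := exists_mem_closure_connectedComponentIn hGd hGc hGb hreal hM hpS
  set W := connectedComponentIn S p with hW
  have hWS : W ⊆ S := connectedComponentIn_subset S p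
  have hWopen : IsOpen W := hSopen.connectedComponentIn
  have hpW : p ∈ W := mem_connectedComponentIn hpS
  have hqim : 0 < q.im := by
    have h1 : 0 ≤ q.im := by
      have : closure W ⊆ {z : ℂ | 0 ≤ z.im} := closure_minimal (fun z hz => (hWS hz).2.1.le)
        (isClosed_le continuous_const Complex.continuous_im)
      exact this hqW
    refine h1.lt_of_ne fun h => ?_
    have : q = 0 := Complex.ext hq0 h.symm
    rw [this, hG0, norm_zero] at hqM
    exact hM.not_gt hqM
  -- near `q`, the right half-plane lies in `W`
  obtain ⟨ρ, κ, hρ, hκ, hnear⟩ : ∃ ρ κ : ℝ, 0 < ρ ∧ 0 < κ ∧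
      ∀ z ∈ Metric.ball q ρ, 0 < z.re → z ∈ W ∧ κ ≤ ‖G z‖ - M := by
    have h1 : ∀ᶠ z in nhdsWithin q {z : ℂ | 0 ≤ z.re}, M + (‖G q‖ - M) / 2 < ‖G z‖ :=
      (hGc q (by simp [hq0])).norm.eventually_const_lt (by linarith)
    rw [eventually_nhdsWithin_iff] at h1
    have h2 : ∀ᶠ z : ℂ in nhds q, 0 < z.im :=
      Complex.continuous_im.continuousAt.eventually_const_lt hqim
    obtain ⟨ρ, hρ, h3⟩ := Metric.eventually_nhds_iff_ball.1 (h1.and h2)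
    have hV : Metric.ball q ρ ∩ {z : ℂ | 0 < z.re} ⊆ S := fun z hz =>
      ⟨hz.2, (h3 z hz.1).2, by
        have := (h3 z hz.1).1 (show (0 : ℝ) ≤ z.re from le_of_lt hz.2)
        linarith⟩
    obtain ⟨w, hw1, hw2⟩ := Metric.mem_closure_iff.1 hqW ρ hρ
    have hwV : w ∈ Metric.ball q ρ ∩ {z : ℂ | 0 < z.re} :=
      ⟨by rwa [Metric.mem_ball, dist_comm], (hWS hw1).1⟩
    have hVpre : IsPreconnected (Metric.ball q ρ ∩ {z : ℂ | 0 < z.re}) :=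
      ((convex_ball q ρ).inter (convex_halfSpace_re_gt 0)).isPreconnected
    refine ⟨ρ, (‖G q‖ - M) / 2, hρ, by linarith, fun z hz hz0 => ⟨?_, ?_⟩⟩
    · rw [hW, connectedComponentIn_eq hw1]
      exact hVpre.subset_connectedComponentIn hwV hV ⟨hz, hz0⟩
    · have := (h3 z hz).1 hz0.le
      linarith
  set δ : ℝ := ρ / 2 with hδ
  have hδ0 : 0 < δ := by positivity
  -- The zero of order `n` at `x₀` cancels the blow-up `1 / (c * r ^ n)` on leaving `x₀`; the zero
  -- at `q` cancels `1 / |re z|` on crossing the imaginary axis; the zero at `conj q` makes `P`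
  -- commute with conjugation.
  set P : ℂ → ℂ := fun z => (z - x₀) ^ n * ((z - q) * (z - starRingEnd ℂ q)) with hP
  have hPc : Continuous P := by fun_prop
  have hPconj : ∀ z, P (starRingEnd ℂ z) = starRingEnd ℂ (P z) := fun z => by
    simp only [hP, map_mul, map_pow, map_sub, Complex.conj_ofReal, Complex.conj_conj]
    ring
  have hP0 : P 0 ≠ 0 := by
    have hq : q ≠ 0 := fun h => by simp [h] at hqim
    simp [hP, hx₀.ne', hq]
  -- the controlled functions
  let A : (ℂ → ℂ) → Prop := fun f =>
    (∀ z : ℂ, z.re < 0 → ‖f z‖ ≤ C / (-z.re)) ∧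
    (∀ z : ℂ, 0 < z.re → M < ‖G z‖ → ‖f z‖ ≤ C / (z.re * (‖G z‖ - M)))
  -- This symmetrization is real on the real axis, and both factors obey the same bounds since `G`
  -- commutes with conjugation. Only the upper half of the loop is then needed.
  let h : (ℂ → ℂ) → ℂ → ℂ := fun f z =>
    (P z * f z) * starRingEnd ℂ (P (starRingEnd ℂ z) * f (starRingEnd ℂ z))
  have hh : ∀ f z, ‖h f z‖ = (‖P z‖ * ‖f z‖) * (‖P z‖ * ‖f (starRingEnd ℂ z)‖) := fun f z => by
    simp only [h, norm_mul, RCLike.norm_conj, hPconj]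
  have hleft : ∀ f, A f → ∀ z : ℂ, z.re < 0 → ‖h f z‖ ≤ (‖P z‖ * (C / (-z.re))) ^ 2 := by
    intro f hf z hz
    rw [hh, pow_two]
    have h1 := hf.1 z hz
    have h2 := hf.1 (starRingEnd ℂ z) (by simpa using hz)
    rw [Complex.conj_re] at h2
    have : 0 ≤ C / (-z.re) := (norm_nonneg _).trans h1
    gcongr
  have hright : ∀ f, A f → ∀ z : ℂ, 0 < z.re → M < ‖G z‖ →
      ‖h f z‖ ≤ (‖P z‖ * (C / (z.re * (‖G z‖ - M)))) ^ 2 := by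
    intro f hf z hz hz'
    rw [hh, pow_two]
    have h1 := hf.2 z hz hz'
    have h2 := hf.2 (starRingEnd ℂ z) (by simpa using hz)
      (by rw [hconj z hz.le, RCLike.norm_conj]; exact hz')
    rw [Complex.conj_re, hconj z hz.le, RCLike.norm_conj] at h2
    have : 0 ≤ C / (z.re * (‖G z‖ - M)) := (norm_nonneg _).trans h1
    gcongr
  have hroot : ∀ f z, P z = 0 → h f z = 0 := fun f z hz => by simp [h, hz]
  -- The plane cut along the closed negative imaginary axis: the upper half of the loop lies in it,
  -- and `h f z / z` has a primitive there.
  set D : Set ℂ := {z : ℂ | -Complex.I * z ∈ Complex.slitPlane} with hD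
  have hDup : ∀ z : ℂ, 0 < z.im → z ∈ D := fun z hz => by
    simp only [hD, Set.mem_ofPred_eq, Complex.mem_slitPlane_iff]
    left; simpa using hz
  have hDre : ∀ z : ℂ, z.re ≠ 0 → z ∈ D := fun z hz => by
    simp only [hD, Set.mem_ofPred_eq, Complex.mem_slitPlane_iff]
    right; simpa using hz
  -- Bounded increment of every primitive of `h f z / z`, uniformly over the controlled `f`. This
  -- replaces contour integrals.
  let R : ℂ → ℂ → Prop := fun u v => ∃ K : ℝ, ∀ f, A f → ∀ Ψ : ℂ → ℂ,
    (∀ z ∈ D, HasDerivAt Ψ (h f z / z) z) → ‖Ψ v - Ψ u‖ ≤ K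
  have hRtrans : ∀ u v w, R u v → R v w → R u w := by
    rintro u v w ⟨K, hK⟩ ⟨L, hL⟩
    refine ⟨L + K, fun f hf Ψ hΨ => ?_⟩
    calc ‖Ψ w - Ψ u‖ = ‖(Ψ w - Ψ v) + (Ψ v - Ψ u)‖ := by ring_nf
      _ ≤ _ := (norm_add_le _ _).trans (add_le_add (hL f hf Ψ hΨ) (hK f hf Ψ hΨ))
  have hRseg : ∀ (s : Set ℂ), Convex ℝ s → s ⊆ D → ∀ B : ℝ,
      (∀ f, A f → ∀ z ∈ s, ‖h f z / z‖ ≤ B) → ∀ u ∈ s, ∀ v ∈ s, R u v := by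
    intro s hs hsD B hB u hu v hv
    exact ⟨B * ‖v - u‖, fun f hf Ψ hΨ => hs.norm_image_sub_le_of_norm_hasDerivWithin_le
      (fun z hz => (hΨ z (hsD hz)).hasDerivWithinAt) (hB f hf) hu hv⟩
  have hdiv : ∀ (w z : ℂ) (a e B : ℝ), ‖w‖ ≤ a → 0 < e → e ≤ ‖z‖ → a / e ≤ B → ‖w / z‖ ≤ B := by
    intro w z a e B hw he hz hB
    rw [norm_div]
    have : 0 ≤ a := (norm_nonneg _).trans hw
    calc ‖w‖ / ‖z‖ ≤ a / e := by gcongr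
      _ ≤ B := hB
  -- from `x₀` to `p`
  have R1 : R x₀ p := by
    have hz : ∀ z ∈ segment ℝ (x₀ : ℂ) p, ∃ r : ℝ, 0 ≤ r ∧ r ≤ r₁ ∧ z = x₀ + r * ω := by
      intro z hz
      rw [segment_eq_image'] at hz
      obtain ⟨θ, ⟨h0, h1⟩, rfl⟩ := hz
      refine ⟨θ * r₁, by positivity, by nlinarith, ?_⟩
      simp [hp, mul_assoc]
    have hre : ∀ z ∈ segment ℝ (x₀ : ℂ) p, x₀ / 2 ≤ z.re := fun z hz' => by
      obtain ⟨r, h0, h1, rfl⟩ := hz z hz'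
      exact hr₁re r h0 h1
    have hcomp : IsCompact (segment ℝ (x₀ : ℂ) p) := by
      rw [segment_eq_image']
      exact isCompact_Icc.image (by fun_prop)
    obtain ⟨a, ha⟩ := hcomp.exists_bound_of_continuousOn
      (f := fun z => ω ^ n * ((z - q) * (z - starRingEnd ℂ q))) (by fun_prop)
    refine hRseg _ (convex_segment _ _) (fun z hz' => hDre z ?_)
      ((a * (C / (x₀ / 2 * c))) ^ 2 / (x₀ / 2)) (fun f hf z hz' => ?_) _
      (left_mem_segment _ _ _) _ (right_mem_segment _ _ _)
    · have := hre z hz'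
      have : 0 < z.re := by linarith
      exact this.ne'
    · have hx := hre z hz'
      have ha' := ha z hz'
      refine hdiv _ _ _ (x₀ / 2) _ ?_ (by positivity) (hx.trans (Complex.re_le_norm z)) le_rfl
      obtain ⟨r, h0, h1, hzr⟩ := hz z hz'
      rcases h0.eq_or_lt with rfl | h0
      · rw [hroot f z (by simp [hP, hzr, hn]), norm_zero]
        positivity
      · have hG1 : M + c * r ^ n ≤ ‖G z‖ := by rw [hzr]; exact hseg r h0 h1
        have hr : 0 < c * r ^ n := by positivity
        have hPz : ‖P z‖ ≤ r ^ n * a := by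
          have : P z = r ^ n * (ω ^ n * ((z - q) * (z - starRingEnd ℂ q))) := by
            have h2 : z - x₀ = r * ω := by rw [hzr]; ring
            simp only [hP]
            rw [h2]; ring
          rw [this, norm_mul, norm_pow, Complex.norm_real, Real.norm_eq_abs, abs_of_pos h0]
          gcongr
        refine (hright f hf z (by linarith) (by linarith)).trans ?_
        have h2 : C / (z.re * (‖G z‖ - M)) ≤ C / (x₀ / 2 * (c * r ^ n)) := by
          gcongr <;> linarith
        have h3 : a * (C / (x₀ / 2 * c)) = r ^ n * a * (C / (x₀ / 2 * (c * r ^ n))) := by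
          field_simp
        rw [h3]
        have h4 : 0 ≤ C / (z.re * (‖G z‖ - M)) :=
          div_nonneg hC (mul_nonneg (by linarith) (by linarith))
        have h5 : 0 ≤ r ^ n * a := (norm_nonneg _).trans hPz
        gcongr
  have hqδ : q + δ ∈ W := by
    refine (hnear _ ?_ (by simp [hq0, hδ0])).1
    rw [Metric.mem_ball, dist_eq_norm, add_sub_cancel_left, Complex.norm_real, Real.norm_eq_abs,
      abs_of_pos hδ0, hδ]
    linarith
  -- The path inside `W` is not explicit: the bound for `h f z / z` is continuous there and `W` is
  -- connected.
  have R2 : R p (q + δ) := by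
    have hB : ContinuousOn (fun z => (‖P z‖ * (C / (z.re * (‖G z‖ - M)))) ^ 2 / ‖z‖) W := by
      have hGW : ContinuousOn G W := hGd.continuousOn.mono fun z hz => (hWS hz).1
      refine ContinuousOn.div ?_ continuous_norm.continuousOn fun z hz => ?_
      · refine (hPc.norm.continuousOn.mul (continuousOn_const.div
          (Complex.continuous_re.continuousOn.mul (hGW.norm.sub continuousOn_const)) ?_)).pow 2
        intro z hz
        exact mul_ne_zero (hWS hz).1.ne' (sub_ne_zero.2 (hWS hz).2.2.ne')
      · refine norm_ne_zero_iff.2 fun h => ?_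
        have := (hWS hz).1
        simp [h] at this
    obtain ⟨K, hK⟩ := exists_norm_sub_le_of_isPreconnected hWopen
      isPreconnected_connectedComponentIn hB hpW hqδ
    refine ⟨K, fun f hf Ψ hΨ => hK Ψ _ (fun z hz => hΨ z (hDup z (hWS hz).2.1)) fun z hz => ?_⟩
    rw [norm_div]
    gcongr
    exact hright f hf z (hWS hz).1 (hWS hz).2.2
  -- At `q + t` both estimates for `f` are of order `1 / |t|`, while `P` has a factor `t`. At `t =
  -- 0`, where neither estimate applies, `h f` vanishes.
  have R3 : R (q + δ) (q - δ) := by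
    have hz : ∀ z ∈ segment ℝ (q + δ) (q - δ), ∃ t : ℝ, |t| ≤ δ ∧ z = q + t := by
      intro z hz
      rw [segment_eq_image'] at hz
      obtain ⟨θ, ⟨h0, h1⟩, rfl⟩ := hz
      refine ⟨δ - 2 * θ * δ, abs_le.2 ⟨by nlinarith, by nlinarith⟩, ?_⟩
      simp
      ring
    have hcomp : IsCompact (segment ℝ (q + δ) (q - δ)) := by
      rw [segment_eq_image']
      exact isCompact_Icc.image (by fun_prop)
    obtain ⟨a, ha⟩ := hcomp.exists_bound_of_continuousOn
      (f := fun z => (z - x₀) ^ n * (z - starRingEnd ℂ q)) (by fun_prop)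
    have hzim : ∀ z ∈ segment ℝ (q + δ) (q - δ), z.im = q.im := fun z hz' => by
      obtain ⟨t, -, rfl⟩ := hz z hz'
      simp
    refine hRseg _ (convex_segment _ _) (fun z hz' => hDup z (by rw [hzim z hz']; exact hqim))
      (((a * C) ^ 2 + (a * (C / κ)) ^ 2) / q.im) (fun f hf z hz' => ?_) _
      (left_mem_segment _ _ _) _ (right_mem_segment _ _ _)
    have ha' := ha z hz'
    refine hdiv _ _ _ q.im _ ?_ hqim ?_ le_rfl
    swap
    · rw [← hzim z hz']; exact (le_abs_self _).trans (Complex.abs_im_le_norm z)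
    obtain ⟨t, ht, hzt⟩ := hz z hz'
    have hzre : z.re = t := by simp [hzt, hq0]
    have hPz : ‖P z‖ ≤ |t| * a := by
      have : P z = t * ((z - x₀) ^ n * (z - starRingEnd ℂ q)) := by
        have h1 : z - q = t := by rw [hzt]; ring
        simp only [hP]
        rw [h1]; ring
      rw [this, norm_mul, Complex.norm_real, Real.norm_eq_abs]
      gcongr
    have h5 : 0 ≤ |t| * a := (norm_nonneg _).trans hPz
    rcases lt_trichotomy t 0 with h0 | h0 | h0
    · refine (hleft f hf z (by rw [hzre]; exact h0)).trans ?_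
      refine le_trans ?_ (le_add_of_nonneg_right (sq_nonneg _))
      have h3 : a * C = |t| * a * (C / (-z.re)) := by
        rw [hzre, abs_of_neg h0]
        have := h0.ne
        field_simp
      rw [h3]
      have h4 : 0 ≤ C / (-z.re) := div_nonneg hC (by linarith)
      gcongr
    · rw [hroot f z (by simp [hP, hzt, h0]), norm_zero]
      positivity
    · have hzball : z ∈ Metric.ball q ρ := by
        rw [Metric.mem_ball, dist_eq_norm, hzt, add_sub_cancel_left, Complex.norm_real,
          Real.norm_eq_abs]
        linarith
      have hk := (hnear z hzball (by linarith)).2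
      refine (hright f hf z (by linarith) (by linarith)).trans ?_
      refine le_trans ?_ (le_add_of_nonneg_left (sq_nonneg _))
      have h2 : C / (z.re * (‖G z‖ - M)) ≤ C / (t * κ) := by
        rw [hzre]
        gcongr
      have h3 : a * (C / κ) = |t| * a * (C / (t * κ)) := by
        rw [abs_of_pos h0]
        field_simp
      rw [h3]
      have h4 : 0 ≤ C / (z.re * (‖G z‖ - M)) :=
        div_nonneg hC (mul_nonneg (by linarith) (by linarith))
      gcongr
  have R4 : R (q - δ) (-δ) := by
    have hre : ∀ z ∈ segment ℝ (q - δ) (-δ : ℂ), z.re = -δ := by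
      intro z hz
      rw [segment_eq_image'] at hz
      obtain ⟨θ, -, rfl⟩ := hz
      simp [hq0]
    have hcomp : IsCompact (segment ℝ (q - δ) (-δ : ℂ)) := by
      rw [segment_eq_image']
      exact isCompact_Icc.image (by fun_prop)
    obtain ⟨a, ha⟩ := hcomp.exists_bound_of_continuousOn hPc.continuousOn
    refine hRseg _ (convex_segment _ _) (fun z hz' => hDre z (by rw [hre z hz']; linarith))
      ((a * (C / δ)) ^ 2 / δ) (fun f hf z hz' => ?_) _
      (left_mem_segment _ _ _) _ (right_mem_segment _ _ _)
    have hz := hre z hz'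
    refine hdiv _ _ _ δ _ ?_ hδ0 ?_ le_rfl
    · refine (hleft f hf z (by linarith)).trans ?_
      rw [hz, neg_neg]
      have := ha z hz'
      gcongr
    · have := Complex.abs_re_le_norm z
      rwa [hz, abs_neg, abs_of_pos hδ0] at this
  obtain ⟨K, hK⟩ : R x₀ (-δ) := hRtrans _ _ _ R1 (hRtrans _ _ _ R2 (hRtrans _ _ _ R3 R4))
  -- The half-loop will give `(‖P 0‖ * ‖f 0‖) ^ 2 * π ≤ K`.
  refine ⟨√(K / Real.pi) / ‖P 0‖, fun f hfd hf1 hf2 => ?_⟩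
  set g : ℂ → ℂ := h f with hg
  have hgd : Differentiable ℂ g := by
    have h1 : Differentiable ℂ fun z => P z * f z := by fun_prop
    have h2 : Differentiable ℂ fun z =>
        starRingEnd ℂ (P (starRingEnd ℂ z) * f (starRingEnd ℂ z)) := fun z => by
      have := (h1 (starRingEnd ℂ z)).conj_conj
      rwa [Complex.conj_conj] at this
    exact h1.mul h2
  have hgreal : ∀ t : ℝ, (g t).im = 0 := fun t => by
    simp only [hg, h, Complex.conj_ofReal, Complex.mul_conj, Complex.ofReal_im]
  have hg0 : g 0 = ((‖P 0‖ * ‖f 0‖) ^ 2 : ℝ) := by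
    simp only [hg, h, map_zero, Complex.mul_conj, Complex.normSq_eq_norm_sq, norm_mul]
  have hdd : Differentiable ℂ (dslope g 0) := by
    rw [← differentiableOn_univ, Complex.differentiableOn_dslope Filter.univ_mem]
    exact hgd.differentiableOn
  obtain ⟨Φ, hΦ⟩ := hdd.isExactOn_univ
  have hds : ∀ t : ℝ, (dslope g 0 t).im = 0 := by
    have h1 : Continuous fun t : ℝ => (dslope g 0 t).im :=
      Complex.continuous_im.comp (hdd.continuous.comp Complex.continuous_ofReal)
    have h2 := h1.ext_on (dense_compl_singleton (0 : ℝ)) continuous_const (g := fun _ => 0) ?_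
    · exact fun t => congrFun h2 t
    · intro t ht
      have ht' : (t : ℂ) ≠ 0 := by simpa using ht
      simp only [dslope_of_ne _ ht', slope_def_module, sub_zero, smul_eq_mul]
      rw [← Complex.ofReal_inv, Complex.im_ofReal_mul, Complex.sub_im, hgreal, hg0,
        Complex.ofReal_im]
      simp
  -- The regular part of `g z / z` is real on the real axis, so its primitive has equal imaginary
  -- parts at both ends. Only the logarithm contributes, with change of argument `π`.
  have hΦre : (Φ (-δ)).im = (Φ x₀).im := by
    have h1 : ∀ t : ℝ, HasDerivAt (fun t : ℝ => (Φ t).im) 0 t := fun t => by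
      have h2 := (hΦ t (Set.mem_univ _)).comp_ofReal
      have h3 := (Complex.imCLM.hasFDerivAt.comp_hasDerivAt t h2)
      simpa [hds t] using! h3
    have h4 := is_const_of_deriv_eq_zero (fun t => (h1 t).differentiableAt) (fun t => (h1 t).deriv)
      (-δ) x₀
    simpa using h4
  have hΨ : ∀ z ∈ D, HasDerivAt (fun z => Φ z + g 0 * Complex.log (-Complex.I * z)) (g z / z) z := by
    intro z hz
    have hz0 : z ≠ 0 := by
      rintro rfl
      simp [hD] at hz
    have h1 : HasDerivAt (fun z => Complex.log (-Complex.I * z)) (-Complex.I / (-Complex.I * z)) z := by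
      have := ((hasDerivAt_id z).const_mul (-Complex.I)).clog hz
      simpa using! this
    convert! (hΦ z (Set.mem_univ _)).add (h1.const_mul (g 0)) using 1
    rw [dslope_of_ne _ hz0, slope_def_field]
    field_simp
    ring
  have hfin := (Complex.abs_im_le_norm _).trans (hK f ⟨hf1, hf2⟩ _ hΨ)
  have hl1 : (Complex.log (-Complex.I * x₀)).im = -(Real.pi / 2) := by
    rw [Complex.log_im, mul_comm, Complex.arg_real_mul _ hx₀, Complex.arg_neg_I]
  have hl2 : (Complex.log (-Complex.I * (-δ))).im = Real.pi / 2 := by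
    rw [Complex.log_im, neg_mul_neg, mul_comm, Complex.arg_real_mul _ hδ0, Complex.arg_I]
  have him : (Φ (-δ) + g 0 * Complex.log (-Complex.I * (-δ)) -
      (Φ x₀ + g 0 * Complex.log (-Complex.I * x₀))).im = (‖P 0‖ * ‖f 0‖) ^ 2 * Real.pi := by
    rw [hg0, Complex.sub_im, Complex.add_im, Complex.add_im, Complex.im_ofReal_mul,
      Complex.im_ofReal_mul, hl1, hl2, hΦre]
    ring
  rw [him] at hfin
  have h5 : (‖P 0‖ * ‖f 0‖) ^ 2 ≤ K / Real.pi := by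
    rw [le_div_iff₀ Real.pi_pos]; exact (le_abs_self _).trans hfin
  rw [le_div_iff₀ (norm_pos_iff.2 hP0), mul_comm]
  exact Real.le_sqrt_of_sq_le h5

/-! ### Decay of quasinilpotent semigroups and transforms of their orbits -/

/-- The powers of an operator with spectral radius zero decay faster than any exponential. -/
theorem exists_norm_pow_le_of_spectralRadius_eq_zero {A : Type*} [NormedRing A] [NormedAlgebra ℂ A]
    [CompleteSpace A] {a : A} (ha : spectralRadius ℂ a = 0) (b : ℝ) :
    ∃ C : ℝ, 0 ≤ C ∧ ∀ n : ℕ, ‖a ^ n‖ ≤ C * Real.exp (-b * n) := by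
  have h1 := spectrum.pow_norm_pow_one_div_tendsto_nhds_spectralRadius a
  rw [ha] at h1
  have h2 : ∀ᶠ n : ℕ in Filter.atTop,
      ENNReal.ofReal (‖a ^ n‖ ^ (1 / n : ℝ)) < ENNReal.ofReal (Real.exp (-b)) :=
    h1.eventually_lt_const (by simpa using Real.exp_pos _)
  obtain ⟨N, hN⟩ := Filter.eventually_atTop.1 (h2.and (Filter.eventually_gt_atTop 0))
  -- Gelfand's formula handles `n ≥ N` with constant `1`; the sum absorbs the finitely many
  -- remaining powers.
  refine ⟨1 + ∑ k ∈ Finset.range N, ‖a ^ k‖ * Real.exp (b * k), by positivity, fun n => ?_⟩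
  rcases lt_or_ge n N with hn | hn
  · have h3 : ‖a ^ n‖ * Real.exp (b * n) ≤ ∑ k ∈ Finset.range N, ‖a ^ k‖ * Real.exp (b * k) :=
      Finset.single_le_sum (f := fun k : ℕ => ‖a ^ k‖ * Real.exp (b * k))
        (fun k _ => by positivity) (Finset.mem_range.2 hn)
    calc ‖a ^ n‖ = ‖a ^ n‖ * Real.exp (b * n) * Real.exp (-b * n) := by
          rw [mul_assoc, ← Real.exp_add]; simp
      _ ≤ _ := by gcongr; linarith
  · obtain ⟨h3, h4⟩ := hN n hn
    rw [ENNReal.ofReal_lt_ofReal_iff (Real.exp_pos _)] at h3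
    have h5 : ‖a ^ n‖ = (‖a ^ n‖ ^ (1 / n : ℝ)) ^ n := by
      rw [← Real.rpow_natCast, ← Real.rpow_mul (norm_nonneg _), one_div,
        inv_mul_cancel₀ (by positivity), Real.rpow_one]
    have h6 : ‖a ^ n‖ ≤ Real.exp (-b * n) := by
      rw [h5, mul_comm, Real.exp_nat_mul]
      exact pow_le_pow_left₀ (by positivity) h3.le n
    have h7 : 0 ≤ ∑ k ∈ Finset.range N, ‖a ^ k‖ * Real.exp (b * k) := by positivity
    nlinarith [Real.exp_pos (-b * n)]

section Semigroup

variable {X : Type*} [NormedAddCommGroup X] [NormedSpace ℂ X] {T : ℝ → X →L[ℂ] X}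

theorem IsStronglyContinuousSemigroup.exists_norm_le_of_mem_Icc [CompleteSpace X]
    (hT : IsStronglyContinuousSemigroup T) {a : ℝ} (ha : 0 < a) (b : ℝ) :
    ∃ C : ℝ, 0 ≤ C ∧ ∀ t ∈ Set.Icc a b, ‖T t‖ ≤ C := by
  have h1 : ∀ x : X, ∃ C, ∀ i : Set.Icc a b, ‖T i x‖ ≤ C := fun x => by
    obtain ⟨C, hC⟩ := isCompact_Icc.exists_bound_of_continuousOn
      ((hT.continuousOn x).mono fun t (ht : t ∈ Set.Icc a b) => ha.trans_le ht.1)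
    exact ⟨C, fun i => hC i i.2⟩
  obtain ⟨C, hC⟩ := banach_steinhaus h1
  exact ⟨max C 0, le_max_right _ _, fun t ht => (hC ⟨t, ht⟩).trans (le_max_left _ _)⟩

theorem IsStronglyContinuousSemigroup.map_natCast_add (hT : IsStronglyContinuousSemigroup T)
    (n : ℕ) {r : ℝ} (hr : 0 < r) : T (n + r) = T 1 ^ n * T r := by
  induction n with
  | zero => simp
  | succ n ih =>
    rw [pow_succ', mul_assoc, ← ih, Nat.cast_succ, add_comm (n : ℝ) 1, add_assoc,
      hT.map_add 1 (n + r) one_pos (by positivity)]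
    rfl

/-- A quasinilpotent semigroup decays at infinity faster than any exponential. -/
theorem IsStronglyContinuousSemigroup.exists_norm_le_exp [CompleteSpace X] (hT : IsStronglyContinuousSemigroup T)
    (hq : IsQuasinilpotent T) {a : ℝ} (ha : 0 < a) {b : ℝ} (hb : 0 ≤ b) :
    ∃ C : ℝ, 0 ≤ C ∧ ∀ t : ℝ, a ≤ t → ‖T t‖ ≤ C * Real.exp (-b * t) := by
  obtain ⟨C₁, h₁, hC₁⟩ := exists_norm_pow_le_of_spectralRadius_eq_zero (hq 1 one_pos) b
  obtain ⟨C₂, h₂, hC₂⟩ := hT.exists_norm_le_of_mem_Icc ha (a + 1)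
  refine ⟨C₁ * C₂ * Real.exp (b * (a + 1)), by positivity, fun t ht => ?_⟩
  -- Subtracting `a` first keeps the remainder `t - n` in `[a, a + 1]`, away from `0`, where the
  -- semigroup may be unbounded.
  set n := ⌊t - a⌋₊ with hn
  have hn1 : (n : ℝ) ≤ t - a := Nat.floor_le (by linarith)
  have hn2 : t - a < n + 1 := Nat.lt_floor_add_one _
  have h3 : T t = T 1 ^ n * T (t - n) := by
    rw [← hT.map_natCast_add n (by linarith)]; congr 1; ring
  rw [h3]
  calc ‖T 1 ^ n * T (t - n)‖ ≤ ‖T 1 ^ n‖ * ‖T (t - n)‖ := norm_mul_le _ _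
    _ ≤ (C₁ * Real.exp (-b * n)) * C₂ := by
        gcongr
        · exact hC₁ n
        · exact hC₂ _ ⟨by linarith, by linarith⟩
    _ = C₁ * C₂ * Real.exp (-b * n) := by ring
    _ ≤ C₁ * C₂ * Real.exp (b * (a + 1) + -b * t) := by
        gcongr
        nlinarith
    _ = _ := by rw [Real.exp_add]; ring

theorem IsStronglyContinuousSemigroup.continuous_dilation (hT : IsStronglyContinuousSemigroup T)
    {s : ℝ} (hs : 0 < s) (x : X) : Continuous fun ξ : Set.Ioi (0 : ℝ) => T (s * (ξ : ℝ)) x := by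
  refine (hT.continuousOn x).comp_continuous (by fun_prop) fun ξ => ?_
  exact mul_pos hs ξ.2

/-- The operators `x ↦ ∫ g ξ • T (s ξ) x dm(ξ)` are bounded. -/
theorem IsStronglyContinuousSemigroup.exists_clm_eq_integral [CompleteSpace X] (hT : IsStronglyContinuousSemigroup T)
    {m : Measure (Set.Ioi (0 : ℝ))} [IsFiniteMeasure m] {g : Set.Ioi (0 : ℝ) → ℂ}
    (hg : Measurable g) (hg1 : ∀ ξ, ‖g ξ‖ ≤ 1) {s : ℝ} (hs : 0 < s)
    (hint : ∀ x, Integrable (fun ξ : Set.Ioi (0 : ℝ) => T (s * (ξ : ℝ)) x) m) :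
    ∃ P : X →L[ℂ] X, ∀ x, P x = ∫ ξ, g ξ • T (s * (ξ : ℝ)) x ∂m := by
  have hgint : ∀ x, Integrable (fun ξ : Set.Ioi (0 : ℝ) => g ξ • T (s * (ξ : ℝ)) x) m := fun x =>
    (hint x).bdd_smul 1 hg.aestronglyMeasurable (Filter.Eventually.of_forall hg1)
  -- On these truncations `T` is uniformly bounded, so the partial integrals are bounded operators.
  -- Their pointwise limit is bounded by Banach–Steinhaus.
  let S : ℕ → Set (Set.Ioi (0 : ℝ)) := fun n => {ξ | (1 / (n + 1) : ℝ) ≤ ξ ∧ (ξ : ℝ) ≤ n}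
  have hS : ∀ n, MeasurableSet (S n) := fun n =>
    (measurableSet_le measurable_const measurable_subtype_coe).inter
      (measurableSet_le measurable_subtype_coe measurable_const)
  have hP : ∀ n, ∃ P : X →L[ℂ] X, ∀ x, P x = ∫ ξ in S n, g ξ • T (s * (ξ : ℝ)) x ∂m := by
    intro n
    have hn : (0 : ℝ) < 1 / (n + 1) := by positivity
    obtain ⟨C, hC0, hC⟩ := hT.exists_norm_le_of_mem_Icc (mul_pos hs hn) (s * n)
    refine ⟨LinearMap.mkContinuous
      { toFun := fun x => ∫ ξ in S n, g ξ • T (s * (ξ : ℝ)) x ∂m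
        map_add' := fun x y => by
          simp only [_root_.map_add, smul_add]
          exact integral_add (hgint x).integrableOn (hgint y).integrableOn
        map_smul' := fun c x => by
          simp only [map_smul, RingHom.id_apply, smul_comm _ c]
          exact integral_smul c _ } (C * m.real (S n)) ?_, fun x => rfl⟩
    intro x
    refine (norm_setIntegral_le_of_norm_le_const (C := C * ‖x‖) (measure_lt_top _ _) ?_).trans_eq
      (by ring)
    intro ξ hξ
    rw [norm_smul]
    have h1 : ‖T (s * (ξ : ℝ))‖ ≤ C := hC _ ⟨by gcongr; exact hξ.1, by gcongr; exact hξ.2⟩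
    calc ‖g ξ‖ * ‖T (s * (ξ : ℝ)) x‖ ≤ 1 * (C * ‖x‖) := by
          gcongr
          · exact hg1 ξ
          · exact (T (s * (ξ : ℝ))).le_of_opNorm_le h1 x
      _ = C * ‖x‖ := one_mul _
  choose P hP using hP
  have hlim : Filter.Tendsto (fun n x => P n x) Filter.atTop
      (nhds fun x => ∫ ξ, g ξ • T (s * (ξ : ℝ)) x ∂m) := by
    refine tendsto_pi_nhds.2 fun x => ?_
    simp only [hP, ← integral_indicator (hS _)]
    refine tendsto_integral_of_dominated_convergence (fun ξ => ‖g ξ • T (s * (ξ : ℝ)) x‖)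
      (fun n => (hgint x).aestronglyMeasurable.indicator (hS n)) (hgint x).norm
      (fun n => Filter.Eventually.of_forall fun ξ => norm_indicator_le_norm_self _ _)
      (Filter.Eventually.of_forall fun ξ => ?_)
    refine tendsto_const_nhds.congr' ?_
    have h1 : ∀ᶠ n : ℕ in Filter.atTop, (1 / (n + 1) : ℝ) < ξ :=
      tendsto_one_div_add_atTop_nhds_zero_nat.eventually_lt_const ξ.2
    filter_upwards [h1, tendsto_natCast_atTop_atTop.eventually_ge_atTop (ξ : ℝ)] with n h2 h3
    rw [Set.indicator_of_mem]
    exact ⟨h2.le, h3⟩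
  exact ⟨continuousLinearMapOfTendsto P hlim, fun x => rfl⟩

/-- The transform `z ↦ ∫ exp (z t) T (s t + a) x dt` of an orbit of a semigroup. -/
noncomputable def orbitTransform (T : ℝ → X →L[ℂ] X) (s a : ℝ) (x : X) (z : ℂ) : X :=
  ∫ t in Set.Ioi (0 : ℝ), Complex.exp (z * t) • T (s * t + a) x

theorem IsStronglyContinuousSemigroup.aestronglyMeasurable_orbit
    (hT : IsStronglyContinuousSemigroup T) {s a : ℝ} (hs : 0 < s) (ha : 0 < a) (x : X)
    {k : ℝ → ℂ} (hk : Continuous k) :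
    AEStronglyMeasurable (fun t : ℝ => k t • T (s * t + a) x) (volume.restrict (Set.Ioi 0)) := by
  refine ContinuousOn.aestronglyMeasurable (hk.continuousOn.smul ?_) measurableSet_Ioi
  refine (hT.continuousOn x).comp (by fun_prop) fun t (ht : 0 < t) => ?_
  exact Set.mem_Ioi.2 (by positivity)

theorem IsStronglyContinuousSemigroup.integrableOn_orbit [CompleteSpace X] (hT : IsStronglyContinuousSemigroup T)
    (hq : IsQuasinilpotent T) {s a : ℝ} (hs : 0 < s) (ha : 0 < a) (x : X) (z : ℂ) :
    IntegrableOn (fun t : ℝ => Complex.exp (z * t) • T (s * t + a) x) (Set.Ioi 0) := by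
  -- At time `s * t + a` this rate absorbs `exp (re z * t)` and leaves a factor `exp (-t)`.
  obtain ⟨C, hC0, hC⟩ := hT.exists_norm_le_exp hq ha
    (b := (|z.re| + 1) / s) (by positivity)
  refine Integrable.mono' ((integrableOn_exp_mul_Ioi (a := -1) (by norm_num) 0).const_mul (C * ‖x‖))
    (hT.aestronglyMeasurable_orbit hs ha x (by fun_prop)) ?_
  refine (ae_restrict_iff' measurableSet_Ioi).2 (Filter.Eventually.of_forall fun t ht => ?_)
  have ht : 0 < t := ht
  have h1 : ‖T (s * t + a) x‖ ≤ C * Real.exp (-((|z.re| + 1) / s) * (s * t + a)) * ‖x‖ :=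
    (T _).le_of_opNorm_le (hC _ (by nlinarith)) x
  have h2 : ‖Complex.exp (z * t)‖ = Real.exp (z.re * t) := by
    rw [Complex.norm_exp]; simp
  rw [norm_smul, h2]
  calc Real.exp (z.re * t) * ‖T (s * t + a) x‖
      ≤ Real.exp (z.re * t) * (C * Real.exp (-((|z.re| + 1) / s) * (s * t + a)) * ‖x‖) := by gcongr
    _ = C * ‖x‖ * Real.exp (z.re * t + -((|z.re| + 1) / s) * (s * t + a)) := by
        rw [Real.exp_add]; ring
    _ ≤ C * ‖x‖ * Real.exp (-1 * t) := by
        gcongr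
        have h3 : -((|z.re| + 1) / s) * (s * t + a) =
          -(|z.re| + 1) * t - (|z.re| + 1) / s * a := by field_simp; ring
        have h4 : 0 ≤ (|z.re| + 1) / s * a := by positivity
        rw [h3]
        nlinarith [le_abs_self z.re]

theorem IsStronglyContinuousSemigroup.differentiable_orbitTransform [CompleteSpace X]
    (hT : IsStronglyContinuousSemigroup T) (hq : IsQuasinilpotent T) {s a : ℝ} (hs : 0 < s)
    (ha : 0 < a) (x : X) : Differentiable ℂ (orbitTransform T s a x) := by
  intro z₀
  -- On the unit ball `re z ≤ z₀.re + 1`, and the factor `t` from differentiation is at most `exp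
  -- t`; hence the exponent `z₀.re + 2`.
  have hb : Integrable (fun t : ℝ => Real.exp ((z₀.re + 2) * t) * ‖T (s * t + a) x‖)
      (volume.restrict (Set.Ioi 0)) := by
    have := (hT.integrableOn_orbit hq hs ha x ((z₀.re + 2 : ℝ) : ℂ)).norm
    refine this.congr (Filter.Eventually.of_forall fun t => ?_)
    simp [norm_smul, Complex.norm_exp]
  have := hasDerivAt_integral_of_dominated_loc_of_deriv_le (𝕜 := ℂ)
    (μ := volume.restrict (Set.Ioi (0 : ℝ))) (x₀ := z₀)
    (F := fun z t => Complex.exp (z * t) • T (s * t + a) x)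
    (F' := fun z t => (t * Complex.exp (z * t)) • T (s * t + a) x) (Metric.ball_mem_nhds z₀ one_pos)
    (Filter.Eventually.of_forall fun z =>
      hT.aestronglyMeasurable_orbit hs ha x (by fun_prop))
    (hT.integrableOn_orbit hq hs ha x z₀)
    (hT.aestronglyMeasurable_orbit hs ha x (by fun_prop)) ?_ hb
    (Filter.Eventually.of_forall fun t z _ => ?_)
  · exact this.2.differentiableAt
  · refine (ae_restrict_iff' measurableSet_Ioi).2 (Filter.Eventually.of_forall fun t ht z hz => ?_)
    have ht : 0 < t := ht
    have h1 : z.re ≤ z₀.re + 1 := by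
      have h2 := (Complex.abs_re_le_norm (z - z₀)).trans (mem_ball_iff_norm.1 hz).le
      rw [Complex.sub_re] at h2
      linarith [le_abs_self (z.re - z₀.re)]
    rw [norm_smul, norm_mul, Complex.norm_exp, Complex.norm_real, Real.norm_eq_abs, abs_of_pos ht]
    gcongr
    calc t * Real.exp (z * t : ℂ).re ≤ Real.exp t * Real.exp ((z₀.re + 1) * t) := by
          gcongr
          · linarith [Real.add_one_le_exp t]
          · simp only [Complex.re_mul_ofReal]
            gcongr
      _ = Real.exp ((z₀.re + 2) * t) := by rw [← Real.exp_add]; ring_nf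
  · have h1 : HasDerivAt (fun z : ℂ => Complex.exp (z * t)) (t * Complex.exp (z * t)) z := by
      have := ((hasDerivAt_id z).mul_const (t : ℂ)).cexp
      simpa [mul_comm] using! this
    exact h1.smul_const _

theorem norm_orbitTransform_le {s a K : ℝ} (hs : 0 < s) {x : X}
    (hK : ∀ t : ℝ, 0 ≤ t → ‖T (t + a) x‖ ≤ K) {z : ℂ} (hz : z.re < 0) :
    ‖orbitTransform T s a x z‖ ≤ K / (-z.re) := by
  have h1 := norm_integral_le_of_norm_le (μ := volume.restrict (Set.Ioi (0 : ℝ)))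
    (f := fun t : ℝ => Complex.exp (z * t) • T (s * t + a) x)
    ((integrableOn_exp_mul_Ioi hz 0).mul_const K) ?_
  · refine h1.trans_eq ?_
    rw [integral_mul_const, integral_exp_mul_Ioi hz]
    simp only [mul_zero, Real.exp_zero]
    rw [neg_div, div_neg]; ring
  · refine (ae_restrict_iff' measurableSet_Ioi).2 (Filter.Eventually.of_forall fun t ht => ?_)
    have ht : 0 < t := ht
    rw [norm_smul, Complex.norm_exp, Complex.re_mul_ofReal]
    gcongr
    exact hK _ (by positivity)

/-- `exp (-z ξ) - T (s ξ)` applied to the transform of an orbit is bounded uniformly in `ξ`. -/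
theorem IsStronglyContinuousSemigroup.norm_exp_smul_sub_le [CompleteSpace X] (hT : IsStronglyContinuousSemigroup T)
    (hq : IsQuasinilpotent T) {s a K : ℝ} (hs : 0 < s) (ha : 0 < a) {x : X}
    (hK : ∀ t : ℝ, 0 ≤ t → ‖T (t + a) x‖ ≤ K) {z : ℂ} (hz : 0 < z.re) {ξ : ℝ} (hξ : 0 < ξ) :
    ‖Complex.exp (-z * ξ) • orbitTransform T s a x z - T (s * ξ) (orbitTransform T s a x z)‖ ≤
      K / z.re := by
  set u : ℝ → X := fun t => Complex.exp (z * t) • T (s * t + a) x with hu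
  have hint : IntegrableOn u (Set.Ioi 0) := hT.integrableOn_orbit hq hs ha x z
  -- Applying `T (s * ξ)` shifts the orbit by `ξ` in the variable `t`, so only the integral over
  -- `[0, ξ]` survives in the difference.
  have h1 : T (s * ξ) (orbitTransform T s a x z) = Complex.exp (-z * ξ) • ∫ t in Set.Ioi ξ, u t := by
    have h2 := (measurePreserving_add_right volume ξ).setIntegral_preimage_emb
      (measurableEmbedding_addRight ξ) u (Set.Ioi ξ)
    rw [orbitTransform, ← ContinuousLinearMap.integral_comp_comm _ hint, ← h2, ← integral_smul]
    have h3 : (fun t : ℝ => t + ξ) ⁻¹' Set.Ioi ξ = Set.Ioi 0 := by ext t; simp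
    rw [h3]
    refine setIntegral_congr_fun measurableSet_Ioi fun t (ht : 0 < t) => ?_
    simp only [hu, map_smul, smul_smul, ← Complex.exp_add]
    have h4 : T (s * (t + ξ) + a) = (T (s * ξ)).comp (T (s * t + a)) := by
      rw [← hT.map_add _ _ (by positivity) (by positivity)]; congr 1; ring
    rw [h4]
    push_cast
    ring_nf
    rfl
  have h2 : ∫ t in Set.Ioi (0 : ℝ), u t = orbitTransform T s a x z := rfl
  rw [h1, ← smul_sub, ← h2, intervalIntegral.integral_Ioi_sub_Ioi hint hξ.le, norm_smul,
    Complex.norm_exp]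
  have h3 : ‖∫ t in (0 : ℝ)..ξ, u t‖ ≤ ∫ t in (0 : ℝ)..ξ, Real.exp (z.re * t) * K := by
    refine intervalIntegral.norm_integral_le_of_norm_le hξ.le
      (Filter.Eventually.of_forall fun t ht => ?_)
      (Continuous.intervalIntegrable (by fun_prop) _ _)
    have ht : 0 < t := ht.1
    simp only [hu]
    rw [norm_smul, Complex.norm_exp, Complex.re_mul_ofReal]
    gcongr
    exact hK _ (by positivity)
  have hK0 : 0 ≤ K := (norm_nonneg _).trans (hK 0 le_rfl)
  rw [intervalIntegral.integral_mul_const, intervalIntegral.integral_comp_mul_left _ hz.ne',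
    integral_exp] at h3
  have h4 : (-z * ξ : ℂ).re = -(z.re * ξ) := by simp
  rw [h4]
  calc Real.exp (-(z.re * ξ)) * ‖∫ t in (0 : ℝ)..ξ, u t‖
      ≤ Real.exp (-(z.re * ξ)) * (z.re⁻¹ • (Real.exp (z.re * ξ) - Real.exp (z.re * 0)) * K) := by
        gcongr
    _ = (1 - Real.exp (-(z.re * ξ))) * (K / z.re) := by
        have h5 : Real.exp (-(z.re * ξ)) * Real.exp (z.re * ξ) = 1 := by rw [← Real.exp_add]; simp
        simp only [mul_zero, Real.exp_zero, smul_eq_mul]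
        linear_combination (z.re⁻¹ * K) * h5
    _ ≤ 1 * (K / z.re) := by
        gcongr
        linarith [Real.exp_pos (-(z.re * ξ))]
    _ = K / z.re := one_mul _

end Semigroup

/-! ### Laplace transforms of bounded densities -/

/-- The Laplace transform of the complex measure `g dm` on `(0, ∞)`. -/
noncomputable def laplaceIntegral (m : Measure (Set.Ioi (0 : ℝ))) (g : Set.Ioi (0 : ℝ) → ℂ)
    (z : ℂ) : ℂ :=
  ∫ ξ, g ξ * Complex.exp (-z * ((ξ : ℝ) : ℂ)) ∂m

section LaplaceIntegral

variable {m : Measure (Set.Ioi (0 : ℝ))} {g : Set.Ioi (0 : ℝ) → ℂ}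

theorem norm_mul_exp_neg_mul_le (hg1 : ∀ ξ, ‖g ξ‖ ≤ 1) {z : ℂ} (hz : 0 ≤ z.re)
    (ξ : Set.Ioi (0 : ℝ)) : ‖g ξ * Complex.exp (-z * ((ξ : ℝ) : ℂ))‖ ≤ 1 := by
  have hξ : 0 < (ξ : ℝ) := ξ.2
  rw [norm_mul, Complex.norm_exp, Complex.re_mul_ofReal, Complex.neg_re]
  refine mul_le_one₀ (hg1 ξ) (Real.exp_pos _).le (Real.exp_le_one_iff.2 ?_)
  nlinarith

theorem aestronglyMeasurable_mul_exp_neg_mul (hg : Measurable g) (z : ℂ) :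
    AEStronglyMeasurable (fun ξ : Set.Ioi (0 : ℝ) => g ξ * Complex.exp (-z * ((ξ : ℝ) : ℂ))) m :=
  (hg.mul (by fun_prop)).aestronglyMeasurable

theorem integrable_mul_exp_neg_mul [IsFiniteMeasure m] (hg : Measurable g) (hg1 : ∀ ξ, ‖g ξ‖ ≤ 1) {z : ℂ}
    (hz : 0 ≤ z.re) :
    Integrable (fun ξ : Set.Ioi (0 : ℝ) => g ξ * Complex.exp (-z * ((ξ : ℝ) : ℂ))) m :=
  Integrable.of_bound (aestronglyMeasurable_mul_exp_neg_mul hg z) 1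
    (Filter.Eventually.of_forall (norm_mul_exp_neg_mul_le hg1 hz))

theorem norm_laplaceIntegral_le [IsFiniteMeasure m] (hg1 : ∀ ξ, ‖g ξ‖ ≤ 1) {z : ℂ} (hz : 0 ≤ z.re) :
    ‖laplaceIntegral m g z‖ ≤ m.real Set.univ := by
  have := norm_integral_le_of_norm_le_const (μ := m) (C := 1)
    (Filter.Eventually.of_forall (norm_mul_exp_neg_mul_le hg1 hz))
  simpa [laplaceIntegral] using! this

theorem continuousOn_laplaceIntegral [IsFiniteMeasure m] (hg : Measurable g) (hg1 : ∀ ξ, ‖g ξ‖ ≤ 1) :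
    ContinuousOn (laplaceIntegral m g) {z | 0 ≤ z.re} := by
  refine continuousOn_of_dominated (bound := fun _ => 1)
    (fun z _ => aestronglyMeasurable_mul_exp_neg_mul hg z)
    (fun z hz => Filter.Eventually.of_forall (norm_mul_exp_neg_mul_le hg1 hz))
    (integrable_const _) (Filter.Eventually.of_forall fun ξ => ?_)
  fun_prop

theorem differentiableOn_laplaceIntegral [IsFiniteMeasure m] (hg : Measurable g) (hg1 : ∀ ξ, ‖g ξ‖ ≤ 1) :
    DifferentiableOn ℂ (laplaceIntegral m g) {z | 0 < z.re} := by
  intro z₀ (hz₀ : 0 < z₀.re)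
  have := hasDerivAt_integral_of_dominated_loc_of_deriv_le (𝕜 := ℂ) (μ := m) (x₀ := z₀)
    (F := fun z (ξ : Set.Ioi (0 : ℝ)) => g ξ * Complex.exp (-z * ((ξ : ℝ) : ℂ)))
    (F' := fun z (ξ : Set.Ioi (0 : ℝ)) => g ξ * (-((ξ : ℝ) : ℂ) * Complex.exp (-z * ((ξ : ℝ) : ℂ))))
    (bound := fun _ => 2 / z₀.re)
    (Metric.ball_mem_nhds z₀ (half_pos hz₀))
    (Filter.Eventually.of_forall fun z => aestronglyMeasurable_mul_exp_neg_mul hg z)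
    (integrable_mul_exp_neg_mul hg hg1 hz₀.le)
    (hg.mul (by fun_prop)).aestronglyMeasurable
    (Filter.Eventually.of_forall fun ξ z hz => ?_) (integrable_const _)
    (Filter.Eventually.of_forall fun ξ z _ => ?_)
  · exact this.2.differentiableAt.differentiableWithinAt
  · have hξ : 0 < (ξ : ℝ) := ξ.2
    have h1 : z₀.re / 2 ≤ z.re := by
      have h2 := (Complex.abs_re_le_norm (z - z₀)).trans (mem_ball_iff_norm.1 hz).le
      rw [Complex.sub_re] at h2
      linarith [neg_abs_le (z.re - z₀.re)]
    rw [norm_mul, norm_mul, norm_neg, Complex.norm_real, Real.norm_eq_abs, abs_of_pos hξ,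
      Complex.norm_exp, Complex.re_mul_ofReal, Complex.neg_re]
    -- With `re z ≥ z₀.re / 2` on the ball, this is `y * exp (-y) ≤ 1` for `y = z₀.re / 2 * ξ`.
    have h3 : (ξ : ℝ) * Real.exp (-z.re * ξ) ≤ 2 / z₀.re := by
      have h4 : z₀.re / 2 * ξ ≤ Real.exp (z₀.re / 2 * ξ) := by
        linarith [Real.add_one_le_exp (z₀.re / 2 * (ξ : ℝ))]
      have h5 : Real.exp (z₀.re / 2 * ξ) * Real.exp (-z.re * ξ) ≤ 1 := by
        rw [← Real.exp_add, Real.exp_le_one_iff]; nlinarith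
      have h6 : z₀.re / 2 * ξ * Real.exp (-z.re * ξ) ≤ 1 :=
        (mul_le_mul_of_nonneg_right h4 (Real.exp_pos _).le).trans h5
      rw [le_div_iff₀ hz₀]
      linarith
    calc ‖g ξ‖ * ((ξ : ℝ) * Real.exp (-z.re * ξ)) ≤ 1 * (2 / z₀.re) := by
          gcongr
          exact hg1 ξ
      _ = _ := one_mul _
  · have h1 : HasDerivAt (fun z : ℂ => Complex.exp (-z * ((ξ : ℝ) : ℂ)))
        (-((ξ : ℝ) : ℂ) * Complex.exp (-z * ((ξ : ℝ) : ℂ))) z := by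
      have := ((hasDerivAt_id z).neg.mul_const ((ξ : ℝ) : ℂ)).cexp
      simpa [mul_comm] using! this
    exact h1.const_mul _

theorem laplaceIntegral_conj (z : ℂ) :
    laplaceIntegral m (fun ξ => starRingEnd ℂ (g ξ)) z =
      starRingEnd ℂ (laplaceIntegral m g (starRingEnd ℂ z)) := by
  rw [laplaceIntegral, laplaceIntegral, ← integral_conj]
  simp [← Complex.exp_conj]

theorem tendsto_laplaceIntegral_atTop [IsFiniteMeasure m] (hg : Measurable g) (hg1 : ∀ ξ, ‖g ξ‖ ≤ 1) :
    Filter.Tendsto (fun x : ℝ => laplaceIntegral m g x) Filter.atTop (nhds 0) := by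
  have := tendsto_integral_filter_of_dominated_convergence (μ := m) (l := Filter.atTop)
    (F := fun (x : ℝ) (ξ : Set.Ioi (0 : ℝ)) => g ξ * Complex.exp (-(x : ℂ) * ((ξ : ℝ) : ℂ)))
    (f := fun _ => 0) (fun _ => 1)
    (Filter.Eventually.of_forall fun x => aestronglyMeasurable_mul_exp_neg_mul hg _) ?_
    (integrable_const _) (Filter.Eventually.of_forall fun ξ => ?_)
  · rwa [integral_zero] at this
  · filter_upwards [Filter.eventually_ge_atTop 0] with x hx
    exact Filter.Eventually.of_forall (norm_mul_exp_neg_mul_le hg1 (by simpa using hx))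
  · have hξ : 0 < (ξ : ℝ) := ξ.2
    have h1 : Filter.Tendsto (fun x : ℝ => Real.exp (-(x * ξ))) Filter.atTop (nhds 0) :=
      Real.tendsto_exp_neg_atTop_nhds_zero.comp (Filter.tendsto_id.atTop_mul_const hξ)
    have h2 := (Complex.continuous_ofReal.tendsto 0).comp h1
    have h3 := h2.const_mul (g ξ)
    simp only [Complex.ofReal_zero, mul_zero] at h3
    refine h3.congr fun x => ?_
    simp

end LaplaceIntegral

/-! ### The functional calculus and the contradiction as `s → 0` -/

section Calculus

variable {X : Type*} [NormedAddCommGroup X] [NormedSpace ℂ X] {T : ℝ → X →L[ℂ] X}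
  {m : Measure (Set.Ioi (0 : ℝ))} {g g' : Set.Ioi (0 : ℝ) → ℂ}

theorem IsStronglyContinuousSemigroup.norm_laplaceIntegral_smul_sub_le
    [CompleteSpace X] [IsFiniteMeasure m]
    (hT : IsStronglyContinuousSemigroup T) (hq : IsQuasinilpotent T) (hg : Measurable g)
    (hg1 : ∀ ξ, ‖g ξ‖ ≤ 1) {s : ℝ} (hs : 0 < s)
    (hint : ∀ x, Integrable (fun ξ : Set.Ioi (0 : ℝ) => T (s * (ξ : ℝ)) x) m) {P : X →L[ℂ] X}
    (hP : ∀ x, P x = ∫ ξ, g ξ • T (s * (ξ : ℝ)) x ∂m) {a K : ℝ} (ha : 0 < a) {x : X}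
    (hK : ∀ t : ℝ, 0 ≤ t → ‖T (t + a) x‖ ≤ K) {z : ℂ} (hz : 0 < z.re) :
    ‖laplaceIntegral m g z • orbitTransform T s a x z - P (orbitTransform T s a x z)‖ ≤
      K / z.re * m.real Set.univ := by
  rw [hP, laplaceIntegral, ← integral_smul_const, ← integral_sub]
  · refine norm_integral_le_of_norm_le_const (Filter.Eventually.of_forall fun ξ => ?_)
    have h1 := hT.norm_exp_smul_sub_le hq hs ha hK hz ξ.2
    rw [mul_smul, ← smul_sub, norm_smul]
    calc _ ≤ 1 * (K / z.re) := by
          gcongr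
          exact hg1 ξ
      _ = _ := one_mul _
  · exact (integrable_mul_exp_neg_mul hg hg1 hz.le).smul_const _
  · exact (hint _).bdd_smul 1 hg.aestronglyMeasurable (Filter.Eventually.of_forall hg1)

theorem IsStronglyContinuousSemigroup.apply_integral_comm [CompleteSpace X]
    (hT : IsStronglyContinuousSemigroup T)
    (hg : Measurable g) (hg1 : ∀ ξ, ‖g ξ‖ ≤ 1) {s : ℝ} (hs : 0 < s)
    (hint : ∀ x, Integrable (fun ξ : Set.Ioi (0 : ℝ) => T (s * (ξ : ℝ)) x) m) {P : X →L[ℂ] X}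
    (hP : ∀ x, P x = ∫ ξ, g ξ • T (s * (ξ : ℝ)) x ∂m) {t : ℝ} (ht : 0 < t) (x : X) :
    T t (P x) = P (T t x) := by
  rw [hP, hP, ← ContinuousLinearMap.integral_comp_comm]
  · refine integral_congr_ae (Filter.Eventually.of_forall fun ξ => ?_)
    have hξ : 0 < s * (ξ : ℝ) := mul_pos hs ξ.2
    have h1 := congrArg (fun A : X →L[ℂ] X => A x) (hT.map_add t _ ht hξ)
    have h2 := congrArg (fun A : X →L[ℂ] X => A x) (hT.map_add _ t hξ ht)
    rw [add_comm] at h1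
    simp only [ContinuousLinearMap.comp_apply] at h1 h2
    simp only [map_smul, ← h1, ← h2]
  · exact (hint _).bdd_smul 1 hg.aestronglyMeasurable (Filter.Eventually.of_forall hg1)

/-- Replacing the operators `Q` and then `P` by the scalars `F'` and `F` costs `O(1 / re z)` each
time. The second replacement acts on the transform of the orbit of `Q x`, since `Q` commutes with
the semigroup. What is left, `P (Q R)`, has norm at most `M * ‖R‖` and is absorbed on the left. -/
theorem IsStronglyContinuousSemigroup.norm_orbitTransform_le_of_norm_comp_le
    [CompleteSpace X] [IsFiniteMeasure m]
    (hT : IsStronglyContinuousSemigroup T) (hq : IsQuasinilpotent T) (hg : Measurable g)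
    (hg1 : ∀ ξ, ‖g ξ‖ ≤ 1) (hg' : Measurable g') (hg1' : ∀ ξ, ‖g' ξ‖ ≤ 1) {s : ℝ} (hs : 0 < s)
    (hint : ∀ x, Integrable (fun ξ : Set.Ioi (0 : ℝ) => T (s * (ξ : ℝ)) x) m) {P Q : X →L[ℂ] X}
    (hP : ∀ x, P x = ∫ ξ, g ξ • T (s * (ξ : ℝ)) x ∂m)
    (hQ : ∀ x, Q x = ∫ ξ, g' ξ • T (s * (ξ : ℝ)) x ∂m) {M : ℝ} (hPQ : ‖P.comp Q‖ ≤ M)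
    {a K : ℝ} (ha : 0 < a) {x : X} (hK : ∀ t : ℝ, 0 ≤ t → ‖T (t + a) x‖ ≤ K) {z : ℂ}
    (hz : 0 < z.re) (hzM : M < ‖laplaceIntegral m g z * laplaceIntegral m g' z‖) :
    ‖orbitTransform T s a x z‖ ≤ 2 * K * m.real Set.univ ^ 2 /
      (z.re * (‖laplaceIntegral m g z * laplaceIntegral m g' z‖ - M)) := by
  set R := orbitTransform T s a x z with hR
  set F := laplaceIntegral m g z with hF
  set F' := laplaceIntegral m g' z with hF'
  set k := m.real Set.univ with hk
  have hk0 : 0 ≤ k := measureReal_nonneg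
  have hKQ : ∀ t : ℝ, 0 ≤ t → ‖T (t + a) (Q x)‖ ≤ K * k := by
    intro t ht
    rw [hT.apply_integral_comm hg' hg1' hs hint hQ (by positivity), hQ]
    refine norm_integral_le_of_norm_le_const (Filter.Eventually.of_forall fun ξ => ?_)
    have hξ : 0 < s * (ξ : ℝ) := mul_pos hs ξ.2
    have h1 := congrArg (fun A : X →L[ℂ] X => A x) (hT.map_add _ (t + a) hξ (by positivity))
    simp only [ContinuousLinearMap.comp_apply] at h1
    rw [← h1, ← add_assoc, norm_smul]
    calc _ ≤ 1 * K := by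
          gcongr
          · exact hg1' ξ
          · exact hK _ (by positivity)
      _ = K := one_mul _
  have hQR : Q R = orbitTransform T s a (Q x) z := by
    rw [hR, orbitTransform, orbitTransform,
      ← ContinuousLinearMap.integral_comp_comm _ (hT.integrableOn_orbit hq hs ha x z)]
    refine setIntegral_congr_fun measurableSet_Ioi fun t (ht : 0 < t) => ?_
    simp only [map_smul]
    rw [hT.apply_integral_comm hg' hg1' hs hint hQ (by positivity)]
  have e1 : ‖F' • R - Q R‖ ≤ K / z.re * k :=
    hT.norm_laplaceIntegral_smul_sub_le hq hg' hg1' hs hint hQ ha hK hz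
  have e2 : ‖F • Q R - P (Q R)‖ ≤ K * k / z.re * k := by
    rw [hQR]
    exact hT.norm_laplaceIntegral_smul_sub_le hq hg hg1 hs hint hP ha hKQ hz
  have e3 : ‖F‖ ≤ k := norm_laplaceIntegral_le hg1 hz.le
  have e4 : ‖P (Q R)‖ ≤ M * ‖R‖ := (P.comp Q).le_of_opNorm_le hPQ R
  have e5 : ‖F * F'‖ * ‖R‖ ≤ k * (K / z.re * k) + K * k / z.re * k + M * ‖R‖ := by
    have h1 : (F * F') • R = F • (F' • R - Q R) + (F • Q R - P (Q R)) + P (Q R) := by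
      rw [smul_sub, mul_smul]; abel
    rw [← norm_smul, h1]
    refine (norm_add_le _ _).trans (add_le_add ((norm_add_le _ _).trans (add_le_add ?_ e2)) e4)
    rw [norm_smul]
    gcongr
  rw [le_div_iff₀ (mul_pos hz (by linarith))]
  have h2 : k * (K / z.re * k) + K * k / z.re * k = 2 * K * k ^ 2 / z.re := by ring
  rw [h2] at e5
  have h3 : ‖R‖ * (‖F * F'‖ - M) ≤ 2 * K * k ^ 2 / z.re := by linarith
  rw [le_div_iff₀ hz] at h3
  linarith

theorem orbitTransform_zero {s : ℝ} (hs : 0 < s) (a : ℝ) (x : X) :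
    orbitTransform T s a x 0 = s⁻¹ • ∫ t in Set.Ioi (0 : ℝ), T (t + a) x := by
  simp only [orbitTransform, zero_mul, Complex.exp_zero, one_smul]
  rw [integral_comp_mul_left_Ioi (fun t => T (t + a) x) 0 hs, mul_zero]

/-- All tail integrals of an orbit vanish, so its primitive is locally constant and its derivative,
the orbit itself, is zero. -/
theorem IsStronglyContinuousSemigroup.eq_zero_of_integral_eq_zero
    [CompleteSpace X]
    (hT : IsStronglyContinuousSemigroup T) (hq : IsQuasinilpotent T)
    (h : ∀ a : ℝ, 0 < a → ∀ x, ∫ t in Set.Ioi (0 : ℝ), T (t + a) x = 0) {a : ℝ} (ha : 0 < a) :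
    T a = 0 := by
  ext x
  have h1 : ∀ b : ℝ, 0 < b → ∫ t in Set.Ioi b, T t x = 0 := fun b hb => by
    have h2 := (measurePreserving_add_right volume b).setIntegral_preimage_emb
      (measurableEmbedding_addRight b) (fun t => T t x) (Set.Ioi b)
    have h3 : (fun t : ℝ => t + b) ⁻¹' Set.Ioi b = Set.Ioi 0 := by ext t; simp
    rw [← h2, h3]
    exact h b hb x
  have hint : IntegrableOn (fun t => T t x) (Set.Ioi (a / 2)) := by
    have h2 := (measurePreserving_add_right volume (a / 2)).integrableOn_comp_preimage
      (measurableEmbedding_addRight (a / 2)) (f := fun t => T t x) (s := Set.Ioi (a / 2))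
    have h3 : (fun t : ℝ => t + a / 2) ⁻¹' Set.Ioi (a / 2) = Set.Ioi 0 := by ext t; simp
    rw [← h2, h3]
    simpa [Function.comp_def] using hT.integrableOn_orbit hq one_pos (half_pos ha) x 0
  have hc : ContinuousAt (fun t => T t x) a := (hT.continuousOn x).continuousAt (Ioi_mem_nhds ha)
  have hd : HasDerivAt (fun u => ∫ t in (a / 2)..u, T t x) (T a x) a := by
    refine intervalIntegral.integral_hasDerivAt_right ?_ ?_ hc
    · exact (intervalIntegrable_iff_integrableOn_Ioc_of_le (by linarith)).2
        (hint.mono_set Set.Ioc_subset_Ioi_self)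
    · exact (hT.continuousOn x).stronglyMeasurableAtFilter isOpen_Ioi _ ha
  have hz : (fun u => ∫ t in (a / 2)..u, T t x) =ᶠ[nhds a] fun _ => 0 := by
    filter_upwards [Ioi_mem_nhds (half_lt_self ha)] with u (hu : a / 2 < u)
    rw [← intervalIntegral.integral_Ioi_sub_Ioi hint hu.le, h1 _ (half_pos ha),
      h1 _ ((half_pos ha).trans hu), sub_zero]
  exact hd.unique ((hasDerivAt_const a (0 : X)).congr_of_eventuallyEq hz)

/-- A quasinilpotent semigroup which violates the lower estimate at arbitrarily small dilations is
trivial. -/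
theorem IsStronglyContinuousSemigroup.eq_zero_of_norm_comp_le
    [CompleteSpace X] [IsFiniteMeasure m]
    (hT : IsStronglyContinuousSemigroup T) (hq : IsQuasinilpotent T) (hg : Measurable g)
    (hg1 : ∀ ξ, ‖g ξ‖ ≤ 1) {M x₀ : ℝ} (hM : 0 < M) (hx₀ : 0 < x₀)
    (hmax : ∀ x : ℝ, 0 ≤ x → ‖laplaceIntegral m g x‖ ^ 2 ≤ M)
    (hMx₀ : ‖laplaceIntegral m g x₀‖ ^ 2 = M) (h0 : laplaceIntegral m g 0 = 0)
    (H : ∀ η : ℝ, 0 < η → ∃ s : ℝ, 0 < s ∧ s ≤ η ∧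
      (∀ x, Integrable (fun ξ : Set.Ioi (0 : ℝ) => T (s * (ξ : ℝ)) x) m) ∧
      ∃ P Q : X →L[ℂ] X, (∀ x, P x = ∫ ξ, g ξ • T (s * (ξ : ℝ)) x ∂m) ∧
        (∀ x, Q x = ∫ ξ, starRingEnd ℂ (g ξ) • T (s * (ξ : ℝ)) x ∂m) ∧ ‖P.comp Q‖ ≤ M)
    {t : ℝ} (ht : 0 < t) : T t = 0 := by
  set g' : Set.Ioi (0 : ℝ) → ℂ := fun ξ => starRingEnd ℂ (g ξ) with hg'
  have hgm' : Measurable g' := Complex.continuous_conj.measurable.comp hg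
  have hg1' : ∀ ξ, ‖g' ξ‖ ≤ 1 := fun ξ => by simpa [hg'] using hg1 ξ
  set G : ℂ → ℂ := fun z => laplaceIntegral m g z * laplaceIntegral m g' z with hG
  have hGreal : ∀ x : ℝ, G x = ((‖laplaceIntegral m g x‖ ^ 2 : ℝ) : ℂ) := fun x => by
    simp only [hG, hg', laplaceIntegral_conj, Complex.conj_ofReal, Complex.mul_conj,
      Complex.normSq_eq_norm_sq]
  refine hT.eq_zero_of_integral_eq_zero hq (fun a ha x => ?_) ht
  obtain ⟨C, hC0, hC⟩ := hT.exists_norm_le_exp hq ha le_rfl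
  have hK : ∀ t : ℝ, 0 ≤ t → ‖T (t + a) x‖ ≤ C * ‖x‖ := fun t ht => by
    have := hC (t + a) (by linarith)
    simp only [neg_zero, zero_mul, Real.exp_zero, mul_one] at this
    exact (T _).le_of_opNorm_le this x
  set K := C * ‖x‖ with hKdef
  have hK0 : 0 ≤ K := by positivity
  set k := m.real Set.univ with hk
  refine SeparatingDual.eq_zero_of_forall_dual_eq_zero (R := ℂ) fun l => ?_
  -- The last argument is one constant dominating the estimates on both half-planes. It does not
  -- involve `s`, so neither does `B`.
  obtain ⟨B, hB⟩ := exists_norm_apply_zero_le (G := G) (M := M) (b := k * k) (x₀ := x₀)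
    ((differentiableOn_laplaceIntegral hg hg1).mul (differentiableOn_laplaceIntegral hgm' hg1'))
    ((continuousOn_laplaceIntegral hg hg1).mul (continuousOn_laplaceIntegral hgm' hg1'))
    (fun z hz => by
      rw [hG, norm_mul]
      exact mul_le_mul (norm_laplaceIntegral_le hg1 hz) (norm_laplaceIntegral_le hg1' hz)
        (norm_nonneg _) measureReal_nonneg)
    (fun z _ => by
      simp only [hG, hg', laplaceIntegral_conj, map_mul, Complex.conj_conj]
      ring)
    (fun x hx => by
      rw [hGreal, Complex.norm_real, Real.norm_eq_abs, abs_of_nonneg (sq_nonneg _)]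
      exact hmax x hx)
    hM hx₀ (by rw [hGreal, hMx₀]) (by simp [hG, h0]) (‖l‖ * (K + 2 * K * k ^ 2))
  by_contra hne
  set I := ∫ t in Set.Ioi (0 : ℝ), T (t + a) x with hI
  have hlI : 0 < ‖l I‖ := norm_pos_iff.2 hne
  have hB0 : 0 ≤ |B| := abs_nonneg B
  -- The bound at `0` reads `‖l I‖ ≤ s * B`, which fails once `s * (|B| + 1) ≤ ‖l I‖`.
  obtain ⟨s, hs, hsη, hint, P, Q, hP, hQ, hPQ⟩ := H (‖l I‖ / (|B| + 1)) (by positivity)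
  have hfin := hB (fun z => l (orbitTransform T s a x z))
    (l.differentiable.comp (hT.differentiable_orbitTransform hq hs ha x)) (fun z hz => ?_)
    (fun z hz hzM => ?_)
  · rw [orbitTransform_zero hs, ← hI, ContinuousLinearMap.map_smul_of_tower, norm_smul, norm_inv, Real.norm_eq_abs,
      abs_of_pos hs, inv_mul_le_iff₀ hs] at hfin
    rw [le_div_iff₀ (by positivity)] at hsη
    nlinarith [le_abs_self B]
  · calc ‖l (orbitTransform T s a x z)‖ ≤ ‖l‖ * (K / -z.re) :=
          l.le_opNorm_of_le (norm_orbitTransform_le hs hK hz)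
      _ ≤ ‖l‖ * ((K + 2 * K * k ^ 2) / -z.re) := by
          have : 0 < -z.re := by linarith
          gcongr
          have : 0 ≤ 2 * K * k ^ 2 := by positivity
          linarith
      _ = _ := by ring
  · have h1 : 0 < ‖G z‖ - M := by linarith
    calc ‖l (orbitTransform T s a x z)‖ ≤ ‖l‖ * (2 * K * k ^ 2 / (z.re * (‖G z‖ - M))) :=
          l.le_opNorm_of_le (hT.norm_orbitTransform_le_of_norm_comp_le hq hg hg1 hgm' hg1' hs hint
            hP hQ hPQ ha hK hz hzM)
      _ ≤ ‖l‖ * ((K + 2 * K * k ^ 2) / (z.re * (‖G z‖ - M))) := by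
          gcongr
          linarith
      _ = _ := by ring

end Calculus

/-! ### Complex measures: polar decomposition and integration -/

section ComplexMeasure

variable {α : Type*} [MeasurableSpace α]

theorem isFiniteMeasure_variation (μ : ComplexMeasure α) : IsFiniteMeasure μ.variation := by
  refine isFiniteMeasure_of_le
    ((ComplexMeasure.re μ).totalVariation + (ComplexMeasure.im μ).totalVariation) ?_
  refine VectorMeasure.variation_le_of_forall_enorm_le fun E _ => ?_
  have h1 : μ E = (ComplexMeasure.re μ E : ℂ) + (ComplexMeasure.im μ E : ℂ) * Complex.I := by
    have : ComplexMeasure.re μ E = (μ E).re ∧ ComplexMeasure.im μ E = (μ E).im := ⟨rfl, rfl⟩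
    rw [this.1, this.2, Complex.re_add_im]
  rw [h1, Measure.add_apply]
  refine (enorm_add_le _ _).trans (add_le_add ?_ ?_)
  · have := (ComplexMeasure.re μ).enorm_le_totalVariation E
    simpa [enorm_eq_nnnorm] using! this
  · have := (ComplexMeasure.im μ).enorm_le_totalVariation E
    simpa [enorm_eq_nnnorm] using! this

/-- A complex measure has a density of modulus at most one with respect to its variation. -/
theorem exists_density_variation (μ : ComplexMeasure α) :
    ∃ g : α → ℂ, Measurable g ∧ (∀ x, ‖g x‖ ≤ 1) ∧
      ∀ E, MeasurableSet E → μ E = ∫ x in E, g x ∂μ.variation := by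
  have := isFiniteMeasure_variation μ
  set m := μ.variation with hm
  have hac : ∀ s : SignedMeasure α, (∀ E, μ E = 0 → s E = 0) → s ≪ᵥ m.toENNRealVectorMeasure := by
    intro s hs E hE
    by_cases hEm : MeasurableSet E
    · rw [Measure.toENNRealVectorMeasure_apply_measurable hEm] at hE
      refine hs E ?_
      have := VectorMeasure.enorm_measure_le_variation μ E
      rw [← hm, hE] at this
      simpa using this
    · exact s.not_measurable hEm
  have hre := SignedMeasure.withDensityᵥ_rnDeriv_eq (ComplexMeasure.re μ) m
    (hac _ fun E hE => congrArg Complex.re hE)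
  have him := SignedMeasure.withDensityᵥ_rnDeriv_eq (ComplexMeasure.im μ) m
    (hac _ fun E hE => congrArg Complex.im hE)
  set u := (ComplexMeasure.re μ).rnDeriv m with hu
  set v := (ComplexMeasure.im μ).rnDeriv m with hv
  have hui : Integrable u m := SignedMeasure.integrable_rnDeriv _ _
  have hvi : Integrable v m := SignedMeasure.integrable_rnDeriv _ _
  have hum : Measurable u := SignedMeasure.measurable_rnDeriv _ _
  have hvm : Measurable v := SignedMeasure.measurable_rnDeriv _ _
  set g₀ : α → ℂ := fun x => u x + v x * Complex.I with hg₀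
  have hg₀m : Measurable g₀ := by fun_prop
  have hg₀i : Integrable g₀ m := hui.ofReal.add (hvi.ofReal.mul_const _)
  have hμ : ∀ E, MeasurableSet E → μ E = ∫ x in E, g₀ x ∂m := by
    intro E hE
    have h1 : ∫ x in E, g₀ x ∂m = (∫ x in E, u x ∂m : ℝ) + (∫ x in E, v x ∂m : ℝ) * Complex.I := by
      rw [hg₀, integral_add (Integrable.restrict hui.ofReal)
        (Integrable.restrict (hvi.ofReal.mul_const _)), integral_mul_const, integral_complex_ofReal, integral_complex_ofReal]
    rw [h1, ← withDensityᵥ_apply hui hE, ← withDensityᵥ_apply hvi hE, hre, him]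
    exact (Complex.re_add_im (μ E)).symm
  have hdens : m.withDensityᵥ g₀ = μ := by
    ext1 E hE
    rw [withDensityᵥ_apply hg₀i hE, hμ E hE]
  -- The variation of `g₀ dm` is `|g₀| dm`, and here it is `m` itself; so the density has modulus
  -- one almost everywhere.
  have hone : (fun x => ‖g₀ x‖ₑ) =ᵐ[m] fun _ => 1 := by
    rw [← withDensity_eq_iff_of_sigmaFinite hg₀m.enorm.aemeasurable aemeasurable_const,
      ← Measure.variation_withDensityᵥ hg₀i, hdens]
    exact withDensity_one.symm
  refine ⟨fun x => if ‖g₀ x‖ ≤ 1 then g₀ x else 0, ?_, fun x => ?_, fun E hE => ?_⟩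
  · exact Measurable.ite (measurableSet_le hg₀m.norm measurable_const) hg₀m measurable_const
  · beta_reduce
    split_ifs with h
    · exact h
    · simp
  · rw [hμ E hE]
    refine integral_congr_ae (ae_restrict_of_ae ?_)
    filter_upwards [hone] with x hx
    have : ‖g₀ x‖ ≤ 1 := by
      rw [← toReal_enorm, hx]; simp
    rw [if_pos this]

/-- The integral against a complex measure which has a bounded density with respect to its
variation. -/
theorem complexIntegral_eq_integral_density {E : Type*} [NormedAddCommGroup E] [NormedSpace ℂ E]
    [CompleteSpace E] {μ : ComplexMeasure α} {m : Measure α} [IsFiniteMeasure m]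
    (hm : μ.variation = m) {g : α → ℂ} (hg : Measurable g) (hg1 : ∀ x, ‖g x‖ ≤ 1)
    (hμ : ∀ S, MeasurableSet S → μ S = ∫ x in S, g x ∂m) {f : α → E} (hf : Integrable f m) :
    complexIntegral μ f = ∫ x, g x • f x ∂m := by
  subst hm
  have hgf : ∀ f : α → E, Integrable f μ.variation →
      Integrable (fun x => g x • f x) μ.variation := fun f hf =>
    hf.bdd_smul 1 hg.aestronglyMeasurable (Filter.Eventually.of_forall hg1)
  refine Integrable.induction (fun f => complexIntegral μ f = ∫ x, g x • f x ∂μ.variation)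
    ?_ ?_ ?_ ?_ hf
  · intro c S hS hSfin
    rw [complexIntegral, VectorMeasure.integral_eq_setToFun, setToFun_indicator_const _ hS hSfin.ne]
    have h1 : (fun x => g x • S.indicator (fun _ => c) x) = S.indicator fun x => g x • c := by
      ext x
      by_cases hx : x ∈ S <;> simp [hx]
    rw [h1, integral_indicator hS, integral_smul_const, ← hμ S hS]
    rfl
  · intro f₁ f₂ _ h₁ h₂ e₁ e₂
    have h3 : (fun x => g x • (f₁ + f₂) x) = fun x => g x • f₁ x + g x • f₂ x := by
      ext x; simp
    rw [h3, integral_add (hgf _ h₁) (hgf _ h₂), ← e₁, ← e₂]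
    exact VectorMeasure.integral_add h₁ h₂
  · refine isClosed_eq VectorMeasure.continuous_integral ?_
    refine continuous_iff_continuousAt.2 fun F => ?_
    refine tendsto_integral_of_L1 _ (hgf _ (L1.integrable_coeFn F)).aestronglyMeasurable ?_ ?_
    · exact Filter.Eventually.of_forall fun G => hgf _ (L1.integrable_coeFn G)
    · have h1 : Filter.Tendsto (fun G : α →₁[μ.variation] E => edist G F) (nhds F) (nhds 0) := by
        have : Continuous fun G : α →₁[μ.variation] E => edist G F := by fun_prop
        simpa using this.tendsto F
      refine tendsto_of_tendsto_of_tendsto_of_le_of_le tendsto_const_nhds h1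
        (fun _ => zero_le) fun G => ?_
      rw [L1.edist_def]
      refine lintegral_mono fun x => ?_
      rw [edist_eq_enorm_sub, ← smul_sub, enorm_smul]
      refine mul_le_of_le_one_left' ?_
      rw [← ofReal_norm]
      exact ENNReal.ofReal_le_one.2 (hg1 x)
  · intro f₁ f₂ h h₁ e₁
    have h2 : complexIntegral μ f₂ = complexIntegral μ f₁ :=
      (VectorMeasure.integral_congr_ae h).symm
    rw [h2, e₁]
    refine integral_congr_ae ?_
    filter_upwards [h] with x hx
    rw [hx]

theorem variation_conjMeasure (μ : ComplexMeasure α) :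
    (conjMeasure μ).variation = μ.variation := by
  have h : ∀ (ν : ComplexMeasure α), (conjMeasure ν).variation ≤ ν.variation := fun ν => by
    refine VectorMeasure.variation_le_of_forall_enorm_le fun E _ => ?_
    have h1 : conjMeasure ν E = starRingEnd ℂ (ν E) := rfl
    have h2 : ‖conjMeasure ν E‖ₑ = ‖ν E‖ₑ := by
      rw [h1, ← ofReal_norm, ← ofReal_norm, RCLike.norm_conj]
    rw [h2]
    exact VectorMeasure.enorm_measure_le_variation ν E
  refine le_antisymm (h μ) ?_
  have h2 : conjMeasure (conjMeasure μ) = μ := by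
    ext1 E _
    exact Complex.conj_conj (μ E)
  calc μ.variation = (conjMeasure (conjMeasure μ)).variation := by rw [h2]
    _ ≤ _ := h _

end ComplexMeasure

/-! ### Injectivity of the Laplace transform -/

/-- A bounded real density whose Fourier transform vanishes is zero. -/
theorem ae_eq_zero_of_integral_mul_exp_I {m : Measure (Set.Ioi (0 : ℝ))} [IsFiniteMeasure m]
    {u : Set.Ioi (0 : ℝ) → ℝ} (hu : Measurable u) (hu1 : ∀ ξ, |u ξ| ≤ 1)
    (h : ∀ y : ℝ, ∫ ξ, (u ξ : ℂ) * Complex.exp (y * ((ξ : ℝ) : ℂ) * Complex.I) ∂m = 0) :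
    u =ᵐ[m] 0 := by
  let p : (Set.Ioi (0 : ℝ) → ℝ) → Measure (Set.Ioi (0 : ℝ)) := fun v =>
    m.withDensity fun ξ => ENNReal.ofReal (v ξ)
  have hfin : ∀ v : Set.Ioi (0 : ℝ) → ℝ, (∀ ξ, v ξ ≤ 1) → IsFiniteMeasure (p v) := fun v hv => by
    refine isFiniteMeasure_withDensity (ne_of_lt ?_)
    calc ∫⁻ ξ, ENNReal.ofReal (v ξ) ∂m ≤ ∫⁻ _, 1 ∂m :=
          lintegral_mono fun ξ => by simpa using hv ξ
      _ < ⊤ := by simp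
  have hchar : ∀ v : Set.Ioi (0 : ℝ) → ℝ, Measurable v → ∀ y : ℝ,
      charFun ((p v).map (↑)) y =
        ∫ ξ, ((max (v ξ) 0 : ℝ) : ℂ) * Complex.exp (y * ((ξ : ℝ) : ℂ) * Complex.I) ∂m := by
    intro v hv y
    rw [charFun_apply_real, integral_map measurable_subtype_coe.aemeasurable (by fun_prop),
      integral_withDensity_eq_integral_toReal_smul hv.ennreal_ofReal (by simp)]
    simp only [ENNReal.toReal_ofReal', Complex.real_smul]
  have hint : ∀ v : Set.Ioi (0 : ℝ) → ℝ, Measurable v → (∀ ξ, |v ξ| ≤ 1) → ∀ y : ℝ,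
      Integrable (fun ξ : Set.Ioi (0 : ℝ) =>
        (v ξ : ℂ) * Complex.exp (y * ((ξ : ℝ) : ℂ) * Complex.I)) m := by
    intro v hv hv1 y
    refine Integrable.of_bound (Measurable.aestronglyMeasurable (by fun_prop)) 1
      (Filter.Eventually.of_forall fun ξ => ?_)
    rw [norm_mul, ← Complex.ofReal_mul, Complex.norm_exp_ofReal_mul_I, mul_one, Complex.norm_real]
    exact hv1 ξ
  have := hfin u fun ξ => (le_abs_self _).trans (hu1 ξ)
  have := hfin (-u) fun ξ => (neg_le_abs _).trans (hu1 ξ)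
  -- The positive and negative parts of `u dm` have the same characteristic function, hence
  -- coincide.
  have heq : (p u).map ((↑) : Set.Ioi (0 : ℝ) → ℝ) = (p (-u)).map (↑) := by
    refine Measure.ext_of_charFun (funext fun y => ?_)
    rw [hchar u hu, hchar (-u) hu.neg, ← sub_eq_zero, ← integral_sub, ← h y]
    · refine integral_congr_ae (Filter.Eventually.of_forall fun ξ => ?_)
      simp only [← sub_mul, ← Complex.ofReal_sub, Pi.neg_apply]
      congr 3
      rcases le_total (u ξ) 0 with h | h
      · rw [max_eq_right h, max_eq_left (by linarith)]; ring
      · rw [max_eq_left h, max_eq_right (by linarith)]; ring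
    · refine hint (fun ξ => max (u ξ) 0) (by fun_prop) (fun ξ => ?_) y
      rw [abs_of_nonneg (le_max_right _ _)]
      exact max_le ((le_abs_self _).trans (hu1 ξ)) zero_le_one
    · refine hint (fun ξ => max (-u ξ) 0) (by fun_prop) (fun ξ => ?_) y
      rw [abs_of_nonneg (le_max_right _ _)]
      exact max_le ((neg_le_abs _).trans (hu1 ξ)) zero_le_one
  have heq' := (MeasurableEmbedding.subtype_coe measurableSet_Ioi).map_injective heq
  rw [withDensity_eq_iff_of_sigmaFinite hu.ennreal_ofReal.aemeasurable
    hu.neg.ennreal_ofReal.aemeasurable] at heq'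
  filter_upwards [heq'] with ξ hξ
  have h1 := congrArg ENNReal.toReal hξ
  simp only [ENNReal.toReal_ofReal', Pi.neg_apply] at h1
  rcases le_total (u ξ) 0 with h | h
  · rw [max_eq_right h, max_eq_left (by linarith)] at h1
    simpa using h1.symm
  · rw [max_eq_left h, max_eq_right (by linarith)] at h1
    simpa using h1

/-- Injectivity of the Laplace transform. -/
theorem ae_eq_zero_of_laplaceIntegral_eq_zero {m : Measure (Set.Ioi (0 : ℝ))} [IsFiniteMeasure m]
    {g : Set.Ioi (0 : ℝ) → ℂ} (hg : Measurable g) (hg1 : ∀ ξ, ‖g ξ‖ ≤ 1)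
    (h : ∀ x : ℝ, 0 ≤ x → laplaceIntegral m g x = 0) : g =ᵐ[m] 0 := by
  have hopen : IsOpen {z : ℂ | 0 < z.re} := isOpen_lt continuous_const Complex.continuous_re
  have h1 : Set.EqOn (laplaceIntegral m g) 0 {z : ℂ | 0 < z.re} := by
    refine ((differentiableOn_laplaceIntegral hg hg1).analyticOnNhd
      hopen).eqOn_zero_of_preconnected_of_frequently_eq_zero
      (convex_halfSpace_re_gt 0).isPreconnected (z₀ := 1) (by simp) ?_
    have h2 : Filter.Tendsto (fun t : ℝ => (t : ℂ)) (nhdsWithin 1 (Set.Ioi 1))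
        (nhdsWithin 1 {1}ᶜ) := by
      refine tendsto_nhdsWithin_iff.2 ⟨?_, ?_⟩
      · have := (Complex.continuous_ofReal.tendsto 1).mono_left
          (nhdsWithin_le_nhds (s := Set.Ioi 1))
        simpa using this
      · filter_upwards [self_mem_nhdsWithin] with t (ht : 1 < t)
        simpa using ht.ne'
    refine h2.frequently (Filter.Eventually.frequently ?_)
    filter_upwards [self_mem_nhdsWithin] with t (ht : 1 < t)
    exact h t (by linarith)
  have h2 : Set.EqOn (laplaceIntegral m g) 0 {z : ℂ | 0 ≤ z.re} := by
    refine h1.of_subset_closure (continuousOn_laplaceIntegral hg hg1) continuousOn_const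
      (fun z (hz : 0 < z.re) => hz.le) ?_
    rw [Complex.closure_setOfPred_lt_re]
  have h3 : ∀ y : ℝ, ∫ ξ, g ξ * Complex.exp (y * ((ξ : ℝ) : ℂ) * Complex.I) ∂m = 0 := fun y => by
    have := h2 (show -(y * Complex.I) ∈ {z : ℂ | 0 ≤ z.re} by simp)
    simp only [laplaceIntegral, neg_neg, Pi.zero_apply] at this
    rw [← this]
    congr 1 with ξ
    ring_nf
  have hgi : ∀ y : ℝ, Integrable (fun ξ : Set.Ioi (0 : ℝ) =>
      g ξ * Complex.exp (y * ((ξ : ℝ) : ℂ) * Complex.I)) m := fun y => by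
    have := integrable_mul_exp_neg_mul (m := m) hg hg1 (z := -(y * Complex.I)) (by simp)
    refine this.congr (Filter.Eventually.of_forall fun ξ => ?_)
    simp only [neg_neg]
    ring_nf
  -- Conjugating the identity at `-y` gives it for `conj g`, so the real and imaginary parts of `g`
  -- can be treated separately.
  have h4 : ∀ y : ℝ, ∫ ξ, starRingEnd ℂ (g ξ) *
      Complex.exp (y * ((ξ : ℝ) : ℂ) * Complex.I) ∂m = 0 := fun y => by
    have := congrArg (starRingEnd ℂ) (h3 (-y))
    rw [← integral_conj, map_zero] at this
    rw [← this]
    congr 1 with ξ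
    simp [← Complex.exp_conj]
  have hgi' : ∀ y : ℝ, Integrable (fun ξ : Set.Ioi (0 : ℝ) =>
      starRingEnd ℂ (g ξ) * Complex.exp (y * ((ξ : ℝ) : ℂ) * Complex.I)) m := fun y => by
    have := Complex.conjCLE.toContinuousLinearMap.integrable_comp (hgi (-y))
    refine this.congr (Filter.Eventually.of_forall fun ξ => ?_)
    simp [← Complex.exp_conj]
  have hre : (fun ξ => (g ξ).re) =ᵐ[m] 0 := by
    refine ae_eq_zero_of_integral_mul_exp_I (by fun_prop)
      (fun ξ => (Complex.abs_re_le_norm _).trans (hg1 ξ)) fun y => ?_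
    have h5 : ∀ ξ, ((g ξ).re : ℂ) * Complex.exp (y * ((ξ : ℝ) : ℂ) * Complex.I) =
        (1 / 2 : ℂ) * (g ξ * Complex.exp (y * ((ξ : ℝ) : ℂ) * Complex.I) +
          starRingEnd ℂ (g ξ) * Complex.exp (y * ((ξ : ℝ) : ℂ) * Complex.I)) := fun ξ => by
      rw [Complex.re_eq_add_conj]; ring
    simp only [h5]
    rw [integral_const_mul, integral_add (hgi y) (hgi' y), h3, h4]
    simp
  have him : (fun ξ => (g ξ).im) =ᵐ[m] 0 := by
    refine ae_eq_zero_of_integral_mul_exp_I (by fun_prop)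
      (fun ξ => (Complex.abs_im_le_norm _).trans (hg1 ξ)) fun y => ?_
    have h5 : ∀ ξ, ((g ξ).im : ℂ) * Complex.exp (y * ((ξ : ℝ) : ℂ) * Complex.I) =
        (1 / (2 * Complex.I) : ℂ) * (g ξ * Complex.exp (y * ((ξ : ℝ) : ℂ) * Complex.I) -
          starRingEnd ℂ (g ξ) * Complex.exp (y * ((ξ : ℝ) : ℂ) * Complex.I)) := fun ξ => by
      rw [Complex.im_eq_sub_conj]; ring
    simp only [h5]
    rw [integral_const_mul, integral_sub (hgi y) (hgi' y), h3, h4]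
    simp
  filter_upwards [hre, him] with ξ h5 h6
  exact Complex.ext h5 h6

/-! ### Existence of the calculus, the maximum, and the conclusion -/

theorem calculusDefined_of_norm_le_or_variation_eq_zero {X : Type*} [NormedAddCommGroup X]
    [NormedSpace ℂ X] [CompleteSpace X] {T : ℝ → X →L[ℂ] X} (hT : IsStronglyContinuousSemigroup T)
    (hq : IsQuasinilpotent T) (μ : ComplexMeasure (Set.Ioi (0 : ℝ)))
    (h : (∃ δ C : ℝ, 0 < δ ∧ ∀ t : ℝ, 0 < t → t ≤ δ → ‖T t‖ ≤ C) ∨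
      (∃ δ : ℝ, 0 < δ ∧ μ.variation {ξ : Set.Ioi (0 : ℝ) | (ξ : ℝ) < δ} = 0))
    {s : ℝ} (hs : 0 < s) : CalculusDefined T μ s := by
  have := isFiniteMeasure_variation μ
  obtain ⟨δ, C, hδ, hC⟩ : ∃ δ C : ℝ, 0 < δ ∧
      ∀ᵐ ξ : Set.Ioi (0 : ℝ) ∂μ.variation, s * (ξ : ℝ) ≤ δ → ‖T (s * (ξ : ℝ))‖ ≤ C := by
    rcases h with ⟨δ, C, hδ, hC⟩ | ⟨δ, hδ, h0⟩
    · exact ⟨δ, C, hδ, Filter.Eventually.of_forall fun ξ hξ => hC _ (mul_pos hs ξ.2) hξ⟩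
    -- Half of `s * δ` forces `ξ < δ` strictly, a null event, so any constant would do in place of
    -- `0`.
    · refine ⟨s * δ / 2, 0, by positivity, ?_⟩
      have h1 : ∀ᵐ ξ : Set.Ioi (0 : ℝ) ∂μ.variation, ¬ (ξ : ℝ) < δ := measure_eq_zero_iff_ae_notMem.1 h0
      filter_upwards [h1] with ξ hξ hξ'
      refine absurd ?_ hξ
      have : 0 < s * δ := by positivity
      exact lt_of_mul_lt_mul_left (by linarith) hs.le
  obtain ⟨C', -, hC'⟩ := hT.exists_norm_le_exp hq hδ le_rfl
  intro x
  refine Integrable.of_bound (hT.continuous_dilation hs x).aestronglyMeasurable (max C C' * ‖x‖) ?_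
  filter_upwards [hC] with ξ hξ
  refine (T _).le_of_opNorm_le ?_ x
  rcases le_total (s * (ξ : ℝ)) δ with h1 | h1
  · exact (hξ h1).trans (le_max_left _ _)
  · have := hC' _ h1
    simp only [neg_zero, zero_mul, Real.exp_zero, mul_one] at this
    exact this.trans (le_max_right _ _)

/-- The modulus of a nonzero Laplace transform vanishing at `0` attains a positive maximum on the
positive half-line. -/
theorem exists_isMaxOn_norm_laplaceIntegral {m : Measure (Set.Ioi (0 : ℝ))} [IsFiniteMeasure m]
    {g : Set.Ioi (0 : ℝ) → ℂ} (hg : Measurable g) (hg1 : ∀ ξ, ‖g ξ‖ ≤ 1)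
    (hne : ¬ g =ᵐ[m] 0) (h0 : laplaceIntegral m g 0 = 0) :
    ∃ x₀ : ℝ, 0 < x₀ ∧ 0 < ‖laplaceIntegral m g x₀‖ ∧
      ∀ x : ℝ, 0 ≤ x → ‖laplaceIntegral m g x‖ ≤ ‖laplaceIntegral m g x₀‖ := by
  obtain ⟨x₁, hx₁, hpos⟩ : ∃ x₁ : ℝ, 0 ≤ x₁ ∧ 0 < ‖laplaceIntegral m g x₁‖ := by
    by_contra! h
    exact hne (ae_eq_zero_of_laplaceIntegral_eq_zero hg hg1 fun x hx =>
      norm_le_zero_iff.1 (h x hx))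
  have hlim := (tendsto_laplaceIntegral_atTop (m := m) hg hg1).norm
  rw [norm_zero] at hlim
  -- Since the transform tends to `0` at infinity, the search for a maximum reduces to a compact
  -- interval containing `x₁`; the value `0` at the origin excludes `x₀ = 0`.
  obtain ⟨R, hR⟩ := Filter.eventually_atTop.1 (hlim.eventually_lt_const hpos)
  have hcont : ContinuousOn (fun x : ℝ => ‖laplaceIntegral m g x‖) (Set.Icc 0 (max R x₁)) := by
    refine ((continuousOn_laplaceIntegral hg hg1).comp Complex.continuous_ofReal.continuousOn
      fun x hx => ?_).norm
    simpa using hx.1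
  obtain ⟨x₀, hx₀, hmax⟩ := isCompact_Icc.exists_isMaxOn ⟨x₁, hx₁, le_max_right _ _⟩ hcont
  have h1 : ‖laplaceIntegral m g x₁‖ ≤ ‖laplaceIntegral m g x₀‖ := hmax ⟨hx₁, le_max_right _ _⟩
  refine ⟨x₀, hx₀.1.lt_of_ne ?_, hpos.trans_le h1, fun x hx => ?_⟩
  · rintro rfl
    rw [Complex.ofReal_zero, h0, norm_zero] at h1
    exact hpos.not_ge h1
  · rcases le_total x (max R x₁) with h2 | h2
    · exact hmax ⟨hx, h2⟩
    · exact (hR x ((le_max_left _ _).trans h2)).le.trans h1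

theorem mainTheorem2 {X : Type*} [NormedAddCommGroup X] [NormedSpace ℂ X] [CompleteSpace X]
    (T : ℝ → X →L[ℂ] X) (hT : IsStronglyContinuousSemigroup T) (hq : IsQuasinilpotent T)
    (hT0 : ∃ t : ℝ, 0 < t ∧ T t ≠ 0)
    (μ : ComplexMeasure (Set.Ioi (0 : ℝ))) (hμ0 : μ ≠ 0) (hμ : μ Set.univ = 0) :
    -- the calculus is defined for every dilation if `T` is bounded near `0`, or if `μ` vanishes there
    (((∃ δ C : ℝ, 0 < δ ∧ ∀ t : ℝ, 0 < t → t ≤ δ → ‖T t‖ ≤ C) ∨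
        (∃ δ : ℝ, 0 < δ ∧ μ.variation {ξ : Set.Ioi (0 : ℝ) | (ξ : ℝ) < δ} = 0)) →
      ∀ s : ℝ, 0 < s → CalculusDefined T μ s) ∧
    -- the lower estimate, at every small dilation at which the calculus is defined
    ∃ M : ℝ, IsGreatest ((fun x : ℝ => ‖laplace μ (x : ℂ)‖ ^ 2) '' Set.Ici 0) M ∧
      ∃ η : ℝ, 0 < η ∧ ∀ s : ℝ, 0 < s → s ≤ η → CalculusDefined T μ s →
        ∃ P Q : X →L[ℂ] X, IsCalculus T μ s P ∧ IsCalculus T (conjMeasure μ) s Q ∧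
          M < ‖P.comp Q‖ := by
  refine ⟨fun h s hs => calculusDefined_of_norm_le_or_variation_eq_zero hT hq μ h hs, ?_⟩
  have := isFiniteMeasure_variation μ
  obtain ⟨g, hg, hg1, hgμ⟩ := exists_density_variation μ
  set m := μ.variation with hm
  have hcg : Measurable fun ξ => starRingEnd ℂ (g ξ) := Complex.continuous_conj.measurable.comp hg
  have hcg1 : ∀ ξ, ‖starRingEnd ℂ (g ξ)‖ ≤ 1 := fun ξ => by simpa using hg1 ξ
  have hcgμ : ∀ S, MeasurableSet S → conjMeasure μ S = ∫ ξ in S, starRingEnd ℂ (g ξ) ∂m := by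
    intro S hS
    rw [integral_conj, ← hgμ S hS]
    rfl
  have hlap : ∀ x : ℝ, 0 ≤ x → laplace μ x = laplaceIntegral m g x := by
    intro x hx
    have h1 := integrable_mul_exp_neg_mul (m := m) (g := fun _ => 1) measurable_const (by simp)
      (z := x) (by simpa using hx)
    simp only [one_mul] at h1
    exact complexIntegral_eq_integral_density hm.symm hg hg1 hgμ h1
  have hne : ¬ g =ᵐ[m] 0 := fun h => hμ0 <| by
    ext1 S hS
    rw [hgμ S hS, integral_congr_ae (ae_restrict_of_ae h)]
    simp
  have h0 : laplaceIntegral m g 0 = 0 := by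
    have h1 := hgμ _ MeasurableSet.univ
    rw [hμ, setIntegral_univ] at h1
    simp [laplaceIntegral, ← h1]
  obtain ⟨x₀, hx₀, hpos, hmax⟩ := exists_isMaxOn_norm_laplaceIntegral hg hg1 hne h0
  refine ⟨‖laplaceIntegral m g x₀‖ ^ 2, ⟨⟨x₀, hx₀.le, ?_⟩, ?_⟩, ?_⟩
  · simp only [hlap x₀ hx₀.le]
  · rintro _ ⟨x, hx, rfl⟩
    simp only [hlap x hx]
    exact pow_le_pow_left₀ (norm_nonneg _) (hmax x hx) 2
  · by_contra! hcon
    obtain ⟨t, ht, hTt⟩ := hT0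
    refine hTt (hT.eq_zero_of_norm_comp_le hq hg hg1 (pow_pos hpos 2) hx₀
      (fun x hx => pow_le_pow_left₀ (norm_nonneg _) (hmax x hx) 2) rfl h0 (fun η hη => ?_) ht)
    obtain ⟨s, hs, hsη, hdef, hall⟩ := hcon η hη
    have hint : ∀ x, Integrable (fun ξ : Set.Ioi (0 : ℝ) => T (s * (ξ : ℝ)) x) m := hdef
    obtain ⟨P, hP⟩ := hT.exists_clm_eq_integral hg hg1 hs hint
    obtain ⟨Q, hQ⟩ := hT.exists_clm_eq_integral hcg hcg1 hs hint
    have hvar : (conjMeasure μ).variation = m := variation_conjMeasure μ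
    refine ⟨s, hs, hsη, hint, P, Q, hP, hQ, hall P Q ⟨hdef, fun x => ?_⟩ ⟨fun x => ?_, fun x => ?_⟩⟩
    · rw [hP, complexIntegral_eq_integral_density hm.symm hg hg1 hgμ (hint x)]
    · rw [VectorMeasure.Integrable, hvar]
      exact hint x
    · rw [hQ, complexIntegral_eq_integral_density hvar hcg hcg1 hcgμ (hint x)]
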